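/- Let $G=(V,E)$ be a finite simple graph. For $d\ge 0$, a *spherical framework* $(G,p)$ in the unit sphere $\mathbb S^{d-1}\subset\mathbb R^d$ is a map $p:V\to\mathbb S^{d-1}$ whose image spans $\mathbb R^d$. $(G,p)$ is *universally rigid* if the Gram matrix $(p(i)\cdot p(j))_{i,j\in V}$ is the only positive semidefinite matrix $X\in\mathbb R^{V\times V}$ with $X_{ii}=1$ for all $i\in V$ and $X_{ij}=p(i)\cdot p(j)$ for all $ij\in E$. $(G,p)$ is *super stable* if (a) there is $\omega\in\mathbb R^{V\cup E}$ such that $\omega(i)p(i)+\sum_{j:\,ij\in E}\omega(ij)p(j)=0$ for every $i\in V$, and such that the symmetric matrix $\Omega\in\mathbb R^{V\times V}$ with $\Omega_{ii}=\omega(i)$, $\Omega_{ij}=\omega(ij)$ for $ij\in E$, and all other entries $0$, is positive semidefinite with $\dim\ker\Omega=d$; and (b) there is no nonzero symmetric $S\in\mathbb R^{d\times d}$ with $p(i)^\top S\,p(i)=0$ for all $i\in V$ and $p(i)^\top S\,p(j)=0$ for all $ij\in E$. A graph is *chordal* if it has no induced cycle of length at least four. **Theorem.** If $G$ is chordal,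 then for every $d$ every universally rigid spherical framework $(G,p)$ in $\mathbb S^{d-1}$ is super stable. Conversely, if $G$ is connected and, for every $d$, every universally rigid spherical framework $(G,p)$ in $\mathbb S^{d-1}$ is super stable, then $G$ is chordal. In particular, for a connected graph $G$, every universally rigid spherical framework $(G,p)$ is super stable if and only if $G$ is chordal. -/

import Mathlib

/-- A graph is chordal if it has no hole, i.e. no induced cycle of length at least four. -/
def IsChordalGraph {V : Type*} (G : SimpleGraph V) : Prop :=
  ∀ n : ℕ, 4 ≤ n → IsEmpty (SimpleGraph.cycleGraph n ↪g G)

/-- A placement of the vertex set `V` on the unit sphere of `ℝ^d` whose points span `ℝ^d`.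
Together with a graph on `V` this is a spherical framework in the unit sphere of `ℝ^d`;
the spanning condition says that its Gram matrix has rank `d`. -/
structure SphericalPlacement (V : Type*) (d : ℕ) where
  /-- the position of each vertex -/
  pos : V → EuclideanSpace ℝ (Fin d)
  norm_pos : ∀ i, ‖pos i‖ = 1
  span_pos : Submodule.span ℝ (Set.range pos) = ⊤

/-- `X` is a solution of the positive semidefinite completion problem on `G` whose prescribed
data are ones on the diagonal and the entries of `A` at the edges of `G`. -/
def IsPSDCompletion {V : Type*} (G : SimpleGraph V) (A X : Matrix V V ℝ) : Prop :=
  X.PosSemidef ∧ (∀ i, X i i = 1) ∧ ∀ i j, G.Adj i j → X i j = A i j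

/-- `(G, p)` is universally rigid if the Gram matrix of `p` is the unique solution of the
completion problem given by the inner products `⟪p i, p j⟫` along the edges of `G`. -/
def IsUniversallyRigid {V : Type*} (G : SimpleGraph V) {d : ℕ}
    (p : SphericalPlacement V d) : Prop :=
  ∀ X : Matrix V V ℝ, IsPSDCompletion G (Matrix.gram ℝ p.pos) X ↔ X = Matrix.gram ℝ p.pos

/-- A stress of `G`: a real weight on every vertex and on every edge. -/
structure SphericalStress {V : Type*} (G : SimpleGraph V) where
  /-- the weights of the vertices -/
  vertex : V → ℝ
  /-- the weights of the edges -/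
  edge : G.edgeSet → ℝ

namespace SphericalStress

variable {V : Type*} {G : SimpleGraph V}

open Classical in
/-- The weight of the edge `ij`, and `0` if `i` and `j` are not adjacent. -/
noncomputable def weight (ω : SphericalStress G) (i j : V) : ℝ :=
  if h : G.Adj i j then ω.edge ⟨s(i, j), h⟩ else 0

open Classical in
/-- The stress matrix `Ω`: vertex weights on the diagonal, edge weights at the edges of `G`,
zeros elsewhere. -/
noncomputable def toMatrix (ω : SphericalStress G) : Matrix V V ℝ :=
  Matrix.of fun i j => if i = j then ω.vertex i else ω.weight i j

/-- The equilibrium condition `ω(i) p(i) + ∑_{ij ∈ E} ω(ij) p(j) = 0` at every vertex `i`. -/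
def IsEquilibrium [Fintype V] (ω : SphericalStress G) {d : ℕ}
    (p : SphericalPlacement V d) : Prop :=
  ∀ i, ω.vertex i • p.pos i + ∑ j, ω.weight i j • p.pos j = 0

end SphericalStress

/-- No nonzero symmetric `d × d` matrix `S` satisfies `p(i)ᵀ S p(i) = 0` for all vertices `i` and
`p(i)ᵀ S p(j) = 0` for all edges `ij`. -/
def IsConicFree {V : Type*} (G : SimpleGraph V) {d : ℕ} (p : SphericalPlacement V d) : Prop :=
  ∀ S : Matrix (Fin d) (Fin d) ℝ, S.IsSymm →
    (∀ i, (p.pos i).ofLp ⬝ᵥ S.mulVec (p.pos i).ofLp = 0) →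
    (∀ i j, G.Adj i j → (p.pos i).ofLp ⬝ᵥ S.mulVec (p.pos j).ofLp = 0) → S = 0

/-- `(G, p)` is super stable if it has an equilibrium stress with positive semidefinite stress
matrix of corank `d` and the points of `p` satisfy the conic condition. -/
def IsSuperStable {V : Type*} [Fintype V] (G : SimpleGraph V) {d : ℕ}
    (p : SphericalPlacement V d) : Prop :=
  (∃ ω : SphericalStress G, ω.IsEquilibrium p ∧ ω.toMatrix.PosSemidef ∧
    Module.finrank ℝ (LinearMap.ker ω.toMatrix.mulVecLin) = d) ∧ IsConicFree G p

/-! For chordal `G`, take as stress matrix the sum over all cliques K of the orthogonal projection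
that kills exactly the vectors agreeing on K with some `i ↦ ⟪p i, y⟫`. It is positive semidefinite
and supported on `G`, and its kernel consists of the v that are coordinate vectors on every clique.
For such v and small ε > 0, the data `⟪p i, p j⟫ - ε v i v j` are positive semidefinite on every
clique, so they have a completion W (`IsChordalGraph.exists_completion`). Then W + ε v vᵀ completes
the original data, hence equals the Gram matrix, and v is a global coordinate vector. So the corank
is d. The conic condition needs no chordality: a nonzero S would give a second completion, built
from I + εS.

Conversely, a hole extends to a maximal partial coloring whose four classes are connected and
contract to a four-cycle. Merging classes suitably and placing them at the standard basis vectors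
and at the unit vector along (1, …, 1) gives a framework with enough adjacencies to be universally
rigid (`colorPlacement_isUniversallyRigid`). The missing adjacencies between opposite classes force
an extra kernel vector on every positive semidefinite equilibrium stress
(`colorPlacement_not_isSuperStable`). -/

/-! ### Induced paths, holes and clique separators. -/

namespace SimpleGraph

variable {V : Type*} {G : SimpleGraph V}

/-- The graph on all of `V` whose edges are the edges of `G` inside `T`. -/
def within (G : SimpleGraph V) (T : Set V) : SimpleGraph V where
  Adj i j := G.Adj i j ∧ i ∈ T ∧ j ∈ T
  symm.symm := fun _ _ h => ⟨h.1.symm, h.2.2, h.2.1⟩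
  loopless.irrefl := fun _ h => h.1.ne rfl

theorem within_mono {S T : Set V} (h : S ⊆ T) : G.within S ≤ G.within T :=
  fun _ _ hij => ⟨hij.1, h hij.2.1, h hij.2.2⟩

/-- A property preserved along the edges is preserved along reachability. -/
theorem Reachable.preserves {P : V → Prop} (hP : ∀ i j, G.Adj i j → P i → P j) {a b : V}
    (h : G.Reachable a b) (ha : P a) : P b := by
  obtain ⟨w⟩ := h
  induction w with
  | nil => exact ha
  | cons h _ ih => exact ih (hP _ _ h ha)

theorem Reachable.mem_of_within {T : Set V} {a b : V} (h : (G.within T).Reachable a b)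
    (ha : a ∈ T) : b ∈ T :=
  Reachable.preserves (G := G.within T) (P := (· ∈ T)) (fun _ _ hij _ => hij.2.2) h ha

/-- Vertices reachable inside `T` are reachable inside the part of `T` reachable from `a`. -/
theorem Reachable.within_component {T : Set V} {a b : V} (h : (G.within T).Reachable a b) :
    (G.within {v | (G.within T).Reachable a v}).Reachable a b := by
  have : ∀ i j, (G.within T).Adj i j →
      ((G.within T).Reachable a i ∧ (G.within {v | (G.within T).Reachable a v}).Reachable a i) →
      ((G.within T).Reachable a j ∧ (G.within {v | (G.within T).Reachable a v}).Reachable a j) := by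
    rintro i j hij ⟨h1, h2⟩
    have h3 : (G.within T).Reachable a j := h1.trans hij.reachable
    exact ⟨h3, h2.trans (Adj.reachable (show (G.within _).Adj i j from ⟨hij.1, h1, h3⟩))⟩
  exact (h.preserves this ⟨Reachable.refl _, Reachable.refl _⟩).2

/-- Leaving a set along a path: some edge crosses its boundary. -/
theorem Reachable.exists_boundary_edge {P : V → Prop} {a b : V} (h : G.Reachable a b)
    (ha : P a) (hb : ¬ P b) : ∃ i j, G.Adj i j ∧ P i ∧ ¬ P j := by
  by_contra! hc
  exact hb (h.preserves hc ha)

/-- A shortest path is induced. -/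
theorem Reachable.exists_induced_path {x y : V} (h : G.Reachable x y) :
    ∃ (m : ℕ) (f : ℕ → V), f 0 = x ∧ f m = y ∧ (∀ i ≤ m, ∀ j ≤ m, f i = f j → i = j) ∧
      (∀ i < m, G.Adj (f i) (f (i + 1))) ∧
      (∀ i ≤ m, ∀ j ≤ m, i < j → G.Adj (f i) (f j) → j = i + 1) := by
  obtain ⟨w, hw⟩ := h.exists_walk_length_eq_dist
  -- Along a geodesic the i-th vertex is at distance i from `x`; this excludes both repetitions and
  -- chords.
  have hd : ∀ i ≤ w.length, G.dist x (w.getVert i) = i := by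
    intro i hi
    have := length_eq_dist_of_subwalk hw (w.isSubwalk_take i)
    rw [← this, Walk.take_length]
    omega
  refine ⟨w.length, w.getVert, by simp, by simp, ?_, ?_, ?_⟩
  · intro i hi j hj hij
    rw [← hd i hi, ← hd j hj, hij]
  · intro i hi
    exact w.adj_getVert_succ hi
  · intro i hi j hj hlt hadj
    have := hadj.diff_dist_adj (u := x)
    rw [hd i hi, hd j hj] at this
    omega

theorem cycleGraph_adj_of_lt {n : ℕ} {i j : Fin n} (hij : i < j) :
    (cycleGraph n).Adj i j ↔ (j.val = i.val + 1 ∨ (i.val = 0 ∧ j.val = n - 1)) := by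
  have hi := i.isLt
  have hj := j.isLt
  have hij' : i.val < j.val := hij
  rw [cycleGraph_adj', Fin.sub_val_of_le hij.le, Fin.val_sub, Nat.mod_eq_of_lt (by omega)]
  omega

/-- Two internally disjoint, mutually non-adjacent induced paths with common ends form a
hole. -/
theorem exists_hole_of_paths {m k : ℕ} (hm : 2 ≤ m) (hk : 2 ≤ k) (f g : ℕ → V)
    (h0 : f 0 = g 0) (h1 : f m = g k)
    (hf : ∀ i ≤ m, ∀ j ≤ m, f i = f j → i = j) (hg : ∀ i ≤ k, ∀ j ≤ k, g i = g j → i = j)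
    (hfa : ∀ i < m, G.Adj (f i) (f (i + 1))) (hga : ∀ i < k, G.Adj (g i) (g (i + 1)))
    (hfi : ∀ i ≤ m, ∀ j ≤ m, i < j → G.Adj (f i) (f j) → j = i + 1)
    (hgi : ∀ i ≤ k, ∀ j ≤ k, i < j → G.Adj (g i) (g j) → j = i + 1)
    (hne : ∀ i j, 0 < i → i < m → 0 < j → j < k → f i ≠ g j)
    (hna : ∀ i j, 0 < i → i < m → 0 < j → j < k → ¬ G.Adj (f i) (g j)) :
    ∃ n, 4 ≤ n ∧ Nonempty (cycleGraph n ↪g G) := by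
  classical
  -- The cycle runs along `f` from 0 to m and returns along `g`; index m + k would be the starting
  -- vertex again.
  let c : ℕ → V := fun i => if i ≤ m then f i else g (m + k - i)
  have cf : ∀ i, i ≤ m → c i = f i := fun i hi => if_pos hi
  have cg : ∀ i, m ≤ i → i ≤ m + k → c i = g (m + k - i) := by
    intro i hi _
    rcases hi.eq_or_lt with rfl | hlt
    · rw [cf _ le_rfl, h1]; congr 1; omega
    · exact if_neg (by omega)
  have key : ∀ i j, i < j → j < m + k →
      c i ≠ c j ∧ (G.Adj (c i) (c j) ↔ (j = i + 1 ∨ (i = 0 ∧ j = m + k - 1))) := by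
    intro i j hij hj
    by_cases hjm : j ≤ m
    · rw [cf i (by omega), cf j hjm]
      refine ⟨fun h => by have := hf i (by omega) j hjm h; omega, ?_, ?_⟩
      · intro h; exact Or.inl (hfi i (by omega) j hjm hij h)
      · rintro (rfl | ⟨_, _⟩)
        · exact hfa i (by omega)
        · omega
    have hgc : ∀ a b, a ≤ k → b < a → (g a ≠ g b ∧ (G.Adj (g a) (g b) ↔ a = b + 1)) := by
      intro a b ha hba
      refine ⟨fun h => by have := hg a ha b (by omega) h; omega, fun h => ?_, fun h => ?_⟩
      · exact hgi b (by omega) a ha hba h.symm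
      · subst h; exact (hga b (by omega)).symm
    by_cases him : m ≤ i
    · rw [cg i him (by omega), cg j (by omega) (by omega)]
      obtain ⟨h2, h3⟩ := hgc (m + k - i) (m + k - j) (by omega) (by omega)
      refine ⟨h2, h3.trans ?_⟩
      omega
    by_cases hi0 : i = 0
    · subst hi0
      rw [cf 0 (by omega), h0, cg j (by omega) (by omega)]
      obtain ⟨h2, h3⟩ := hgc (m + k - j) 0 (by omega) (by omega)
      refine ⟨h2.symm, (G.adj_comm _ _).trans (h3.trans ?_)⟩
      omega
    rw [cf i (by omega), cg j (by omega) (by omega)]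
    refine ⟨hne _ _ (by omega) (by omega) (by omega) (by omega), fun h => ?_, fun h => ?_⟩
    · exact absurd h (hna _ _ (by omega) (by omega) (by omega) (by omega))
    · omega
  refine ⟨m + k, by omega, ⟨⟨⟨fun i => c i.val, ?_⟩, ?_⟩⟩⟩
  · intro i j hij
    rcases lt_trichotomy i j with h | h | h
    · exact absurd hij (key _ _ h j.isLt).1
    · exact h
    · exact absurd hij.symm (key _ _ h i.isLt).1
  · intro i j
    change G.Adj (c i.val) (c j.val) ↔ _
    rcases lt_trichotomy i j with h | h | h
    · rw [cycleGraph_adj_of_lt h, (key _ _ h j.isLt).2]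
    · subst h; simp
    · rw [adj_comm, (cycleGraph (m + k)).adj_comm, cycleGraph_adj_of_lt h, (key _ _ h i.isLt).2]

/-- An induced path from `x` to `y` through a connected set attached to both. -/
theorem exists_induced_path_through {C : Set V} {a x y : V}
    (hC : ∀ v ∈ C, (G.within C).Reachable a v)
    (hx : ∃ v ∈ C, G.Adj x v) (hy : ∃ v ∈ C, G.Adj y v) (hxy : ¬ G.Adj x y) (hne : x ≠ y) :
    ∃ (m : ℕ) (f : ℕ → V), 2 ≤ m ∧ f 0 = x ∧ f m = y ∧ (∀ i ≤ m, ∀ j ≤ m, f i = f j → i = j) ∧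
      (∀ i < m, G.Adj (f i) (f (i + 1))) ∧
      (∀ i ≤ m, ∀ j ≤ m, i < j → G.Adj (f i) (f j) → j = i + 1) ∧
      (∀ i, 0 < i → i < m → f i ∈ C) := by
  obtain ⟨u, hu, hxu⟩ := hx
  obtain ⟨v, hv, hyv⟩ := hy
  -- A shortest path inside C ∪ {x, y} has its interior in C, and it is induced in `G` because every
  -- chord would lie inside D.
  set D : Set V := insert x (insert y C) with hD
  have hCD : C ⊆ D := fun z hz => by simp [hD, hz]
  have hr : (G.within D).Reachable x y := by
    have h1 : (G.within D).Adj x u := ⟨hxu, by simp [hD], hCD hu⟩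
    have h2 : (G.within D).Adj v y := ⟨hyv.symm, hCD hv, by simp [hD]⟩
    have h3 : (G.within D).Reachable u v :=
      ((hC u hu).symm.trans (hC v hv)).mono (within_mono hCD)
    exact h1.reachable.trans (h3.trans h2.reachable)
  obtain ⟨m, f, f0, fm, hinj, hadj, hind⟩ := hr.exists_induced_path
  have hmem : ∀ i ≤ m, f i ∈ D := by
    intro i hi
    rcases hi.eq_or_lt with rfl | hlt
    · rw [fm]; simp [hD]
    · exact (hadj i hlt).2.1
  have hm2 : 2 ≤ m := by
    by_contra hlt
    have : m = 0 ∨ m = 1 := by omega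
    rcases this with rfl | rfl
    · exact hne (f0.symm.trans fm)
    · have := (hadj 0 (by omega)).1
      rw [f0, fm] at this
      exact hxy this
  refine ⟨m, f, hm2, f0, fm, hinj, fun i hi => (hadj i hi).1, ?_, ?_⟩
  · intro i hi j hj hij h
    exact hind i hi j hj hij ⟨h, hmem i hi, hmem j hj⟩
  · intro i hi him
    have h := hmem i him.le
    simp only [hD, Set.mem_insert_iff] at h
    rcases h with h | h | h
    · have := hinj i him.le 0 (by omega) (h.trans f0.symm); omega
    · have := hinj i him.le m le_rfl (h.trans fm.symm); omega
    · exact h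

/-- A set of vertices of a chordal graph containing two non-adjacent vertices has a clique
separator. -/
theorem exists_clique_separation [Finite V] (hG : IsChordalGraph G) {T : Set V} {a b : V}
    (ha : a ∈ T) (hb : b ∈ T) (hne : a ≠ b) (hab : ¬ G.Adj a b) :
    ∃ A B : Set V, A ∪ B = T ∧ a ∉ B ∧ b ∉ A ∧ G.IsClique (A ∩ B) ∧
      ∀ i ∈ A, ∀ j ∈ B, j ∉ A → i ∉ B → ¬ G.Adj i j := by
  classical
  let Sep : Set V → Prop := fun S => S ⊆ T ∧ a ∉ S ∧ b ∉ S ∧ ¬ (G.within (T \ S)).Reachable a b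
  have hex : ∃ S, Sep S := by
    refine ⟨T \ {a, b}, Set.sdiff_subset, by simp, by simp, fun h => ?_⟩
    obtain ⟨i, j, hij, hi, hj⟩ := h.exists_boundary_edge (P := (· = a)) rfl (fun h => hne h.symm)
    have hi : i = a := hi
    subst hi
    have : j = b := by
      have := hij.2.2
      simp only [Set.mem_sdiff, Set.mem_insert_iff, Set.mem_singleton_iff] at this
      by_contra hjb
      exact this.2 ⟨this.1, by tauto⟩
    subst this
    exact hab hij.1
  obtain ⟨S, hS, hmin⟩ := Set.Finite.exists_minimal (s := {S | Sep S}) (Set.toFinite _) hex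
  obtain ⟨hST, haS, hbS, hsep⟩ := hS
  set Ca : Set V := {v | (G.within (T \ S)).Reachable a v} with hCa
  set Cb : Set V := {v | (G.within (T \ S)).Reachable b v} with hCb
  have haCa : a ∈ Ca := Reachable.refl _
  have hCaT : Ca ⊆ T \ S := fun v hv => Reachable.mem_of_within hv ⟨ha, haS⟩
  have hCbT : Cb ⊆ T \ S := fun v hv => Reachable.mem_of_within hv ⟨hb, hbS⟩
  have hclosed : ∀ i ∈ Ca, ∀ j ∈ T \ S, G.Adj i j → j ∈ Ca := fun i hi j hj hij =>
    Reachable.trans hi (Adj.reachable (show (G.within (T \ S)).Adj i j from ⟨hij, hCaT hi, hj⟩))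
  have hdisj : ∀ i ∈ Ca, i ∉ Cb := fun i hi hi' => hsep (Reachable.trans hi hi'.symm)
  -- By minimality each x in S has neighbors in both components: removing x from S reconnects a and
  -- b, and an edge leaving a component can then only end at x. The pair (c, d) covers both sides at
  -- once.
  have hnb : ∀ c d, (c = a ∧ d = b ∨ c = b ∧ d = a) → ∀ x ∈ S,
      ∃ v ∈ {v | (G.within (T \ S)).Reachable c v}, G.Adj x v := by
    intro c d hcd x hx
    have hr : (G.within (T \ (S \ {x}))).Reachable a b := by
      by_contra hc
      have : Sep (S \ {x}) :=
        ⟨Set.sdiff_subset.trans hST, fun h => haS h.1, fun h => hbS h.1, hc⟩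
      exact (hmin this Set.sdiff_subset hx).2 rfl
    have hr' : (G.within (T \ (S \ {x}))).Reachable c d := by
      rcases hcd with ⟨rfl, rfl⟩ | ⟨rfl, rfl⟩
      exacts [hr, hr.symm]
    have hcd' : d ∉ {v | (G.within (T \ S)).Reachable c v} := by
      rcases hcd with ⟨rfl, rfl⟩ | ⟨rfl, rfl⟩
      exacts [hsep, fun h => hsep (Reachable.symm h)]
    have hc : c ∈ T \ S := by
      rcases hcd with ⟨rfl, rfl⟩ | ⟨rfl, rfl⟩
      exacts [⟨ha, haS⟩, ⟨hb, hbS⟩]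
    obtain ⟨i, j, hij, hi, hj⟩ := hr'.exists_boundary_edge
      (P := (· ∈ {v | (G.within (T \ S)).Reachable c v})) (Reachable.refl _) hcd'
    have hiT : i ∈ T \ S := Reachable.mem_of_within hi hc
    have hjx : j = x := by
      by_contra hjx
      have hjT : j ∈ T \ S := ⟨hij.2.2.1, fun h => hij.2.2.2 ⟨h, hjx⟩⟩
      exact hj (Reachable.trans hi (Adj.reachable
        (show (G.within (T \ S)).Adj i j from ⟨hij.1, hiT, hjT⟩)))
    exact ⟨i, hi, hjx ▸ hij.1.symm⟩
  -- The two parts meet exactly in S. Two non-adjacent vertices of S would be joined by induced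
  -- paths through `Ca` and through `Cb`, which together form a hole.
  refine ⟨Ca ∪ S, T \ Ca, ?_, ?_, ?_, ?_, ?_⟩
  · ext v
    simp only [Set.mem_union, Set.mem_sdiff]
    constructor
    · rintro ((h | h) | h)
      exacts [(hCaT h).1, hST h, h.1]
    · tauto
  · exact fun h => h.2 haCa
  · rintro (h | h)
    exacts [hsep h, hbS h]
  · intro x hx y hy hxy
    by_contra hadj
    have hxS : x ∈ S := by
      rcases hx.1 with h | h
      exacts [absurd h hx.2.2, h]
    have hyS : y ∈ S := by
      rcases hy.1 with h | h
      exacts [absurd h hy.2.2, h]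
    obtain ⟨m, f, hm, f0, fm, hf, hfa, hfi, hfC⟩ := exists_induced_path_through (C := Ca)
      (fun v hv => Reachable.within_component hv) (hnb a b (Or.inl ⟨rfl, rfl⟩) x hxS)
      (hnb a b (Or.inl ⟨rfl, rfl⟩) y hyS) hadj hxy
    obtain ⟨k, g, hk, g0, gk, hg, hga, hgi, hgC⟩ := exists_induced_path_through (C := Cb)
      (fun v hv => Reachable.within_component hv) (hnb b a (Or.inr ⟨rfl, rfl⟩) x hxS)
      (hnb b a (Or.inr ⟨rfl, rfl⟩) y hyS) hadj hxy
    obtain ⟨n, hn, ⟨e⟩⟩ := exists_hole_of_paths hm hk f g (f0.trans g0.symm) (fm.trans gk.symm)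
      hf hg hfa hga hfi hgi
      (fun i j hi him hj hjk h => hdisj _ (hfC i hi him) (h ▸ hgC j hj hjk))
      (fun i j hi him hj hjk h =>
        hdisj _ (hclosed _ (hfC i hi him) _ (hCbT (hgC j hj hjk)) h) (hgC j hj hjk))
    exact (hG n hn).false e
  · intro i hi j hj hjA hiB hij
    have hiT : i ∈ T := by
      rcases hi with h | h
      exacts [(hCaT h).1, hST h]
    have hiCa : i ∈ Ca := by
      by_contra h
      exact hiB ⟨hiT, h⟩
    exact hj.2 (hclosed i hiCa j ⟨hj.1, fun h => hjA (Or.inr h)⟩ hij)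

end SimpleGraph

/-! ### Gram matrices and positive semidefinite completion. -/

open scoped RealInnerProductSpace

theorem Matrix.PosSemidef.exists_inner_eq {V : Type*} [Fintype V] {M : Matrix V V ℝ}
    (hM : M.PosSemidef) : ∃ x : V → EuclideanSpace ℝ V, ∀ i j, ⟪x i, x j⟫ = M i j := by
  classical
  open scoped MatrixOrder in
  obtain ⟨B, rfl⟩ := CStarAlgebra.nonneg_iff_eq_star_mul_self.mp hM.nonneg
  refine ⟨fun i => WithLp.toLp 2 fun k => B k i, fun i j => ?_⟩
  simp [Matrix.mul_apply, Matrix.star_apply, PiLp.inner_apply, mul_comm]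

/-- A linear map with prescribed values on a family exists as soon as the values satisfy every
linear relation of the family. -/
theorem LinearMap.exists_apply_eq_of_relations {K ι E F : Type*} [Field K] [Fintype ι]
    [AddCommGroup E] [Module K E] [AddCommGroup F] [Module K F] (q : ι → E) (r : ι → F)
    (h : ∀ c : ι → K, ∑ i, c i • q i = 0 → ∑ i, c i • r i = 0) :
    ∃ L : E →ₗ[K] F, ∀ i, L (q i) = r i := by
  classical
  let f : (ι → K) →ₗ[K] E := Fintype.linearCombination K q
  let g : (ι → K) →ₗ[K] F := Fintype.linearCombination K r
  -- Choose coefficients linearly on the span of `q`, apply them to `r`, and extend; the hypothesis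
  -- makes the choice of coefficients irrelevant.
  obtain ⟨s, hs⟩ := f.rangeRestrict.exists_rightInverse_of_surjective f.range_rangeRestrict
  obtain ⟨L, hL⟩ := (g.comp s).exists_extend
  refine ⟨L, fun i => ?_⟩
  have hq : q i = f (Pi.single i 1) := by simp [f, Fintype.linearCombination_apply_single]
  have hr : r i = g (Pi.single i 1) := by simp [g, Fintype.linearCombination_apply_single]
  have h1 : L (q i) = g (s (f.rangeRestrict (Pi.single i 1))) := by
    rw [hq]; exact LinearMap.congr_fun hL (f.rangeRestrict (Pi.single i 1))
  have h2 : f (s (f.rangeRestrict (Pi.single i 1)) - Pi.single i 1) = 0 := by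
    rw [map_sub, sub_eq_zero]
    exact congrArg Subtype.val (LinearMap.congr_fun hs (f.rangeRestrict (Pi.single i 1)))
  have h3 : g (s (f.rangeRestrict (Pi.single i 1)) - Pi.single i 1) = 0 := h _ h2
  rw [h1, hr, ← sub_eq_zero, ← map_sub, h3]

theorem norm_sum_smul_eq_of_inner_eq {ι E F : Type*} [Fintype ι] [NormedAddCommGroup E]
    [InnerProductSpace ℝ E] [NormedAddCommGroup F] [InnerProductSpace ℝ F] {q : ι → E} {r : ι → F}
    (h : ∀ i j, ⟪q i, q j⟫ = ⟪r i, r j⟫) (c : ι → ℝ) :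
    ‖∑ i, c i • q i‖ = ‖∑ i, c i • r i‖ := by
  rw [← sq_eq_sq₀ (norm_nonneg _) (norm_nonneg _), ← real_inner_self_eq_norm_sq,
    ← real_inner_self_eq_norm_sq]
  simp only [sum_inner, inner_sum, inner_smul_left, inner_smul_right, h]

/-- Two families with the same Gram matrix differ by a linear isometry. -/
theorem exists_linearIsometry_of_inner_eq {ι E : Type*} [Fintype ι] [NormedAddCommGroup E]
    [InnerProductSpace ℝ E] [FiniteDimensional ℝ E] {q r : ι → E}
    (h : ∀ i j, ⟪q i, q j⟫ = ⟪r i, r j⟫) : ∃ U : E →ₗᵢ[ℝ] E, ∀ i, U (q i) = r i := by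
  obtain ⟨L, hL⟩ := LinearMap.exists_apply_eq_of_relations (K := ℝ) q r (by
    intro c hc
    rw [← norm_eq_zero, ← norm_sum_smul_eq_of_inner_eq h, hc, norm_zero])
  let L' : Submodule.span ℝ (Set.range q) →ₗᵢ[ℝ] E :=
    { toLinearMap := L.domRestrict _
      norm_map' := by
        rintro ⟨x, hx⟩
        obtain ⟨c, rfl⟩ := (Submodule.mem_span_range_iff_exists_fun ℝ).1 hx
        simp only [LinearMap.domRestrict_apply, map_sum, map_smul, hL]
        exact (norm_sum_smul_eq_of_inner_eq h c).symm }
  refine ⟨L'.extend, fun i => ?_⟩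
  have := L'.extend_apply ⟨q i, Submodule.subset_span ⟨i, rfl⟩⟩
  rw [this]
  exact hL i

/-- **Positive semidefinite completion on chordal graphs**: data that are realised by vectors on
every clique are realised by vectors globally. -/
theorem IsChordalGraph.exists_completion {V : Type*} [Fintype V] {G : SimpleGraph V}
    (hG : IsChordalGraph G) (a : V → V → ℝ)
    (ha : ∀ K : Set V, G.IsClique K →
      ∃ u : V → EuclideanSpace ℝ V, ∀ i ∈ K, ∀ j ∈ K, ⟪u i, u j⟫ = a i j) :
    ∃ w : V → EuclideanSpace ℝ V, (∀ i, ⟪w i, w i⟫ = a i i) ∧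
      ∀ i j, G.Adj i j → ⟪w i, w j⟫ = a i j := by
  classical
  suffices H : ∀ T : Set V, ∃ w : V → EuclideanSpace ℝ V, ∀ i ∈ T, ∀ j ∈ T,
      i = j ∨ G.Adj i j → ⟪w i, w j⟫ = a i j by
    obtain ⟨w, hw⟩ := H Set.univ
    exact ⟨w, fun i => hw i trivial i trivial (Or.inl rfl),
      fun i j h => hw i trivial j trivial (Or.inr h)⟩
  intro T
  induction T using WellFoundedLT.induction with
  | ind T ih =>
    by_cases hT : G.IsClique T
    · obtain ⟨u, hu⟩ := ha T hT
      exact ⟨u, fun i hi j hj _ => hu i hi j hj⟩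
    have : ∃ x ∈ T, ∃ y ∈ T, x ≠ y ∧ ¬ G.Adj x y := by
      by_contra! hc
      exact hT fun x hx y hy hxy => hc x hx y hy hxy
    obtain ⟨x, hx, y, hy, hne, hxy⟩ := this
    obtain ⟨A, B, hAB, hxB, hyA, hcl, hno⟩ :=
      SimpleGraph.exists_clique_separation hG hx hy hne hxy
    have hAT : A ⊆ T := hAB ▸ Set.subset_union_left
    have hBT : B ⊆ T := hAB ▸ Set.subset_union_right
    obtain ⟨q, hq⟩ := ih A (lt_of_le_of_ne hAT fun h => hyA (h ▸ hy))
    obtain ⟨r, hr⟩ := ih B (lt_of_le_of_ne hBT fun h => hxB (h ▸ hx))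
    -- The overlap is a clique, so the data fix all inner products there: the two partial
    -- realizations are congruent on A ∩ B and can be glued by an isometry.
    obtain ⟨U, hU⟩ := exists_linearIsometry_of_inner_eq
      (q := fun i : (A ∩ B : Set V) => r i) (r := fun i : (A ∩ B : Set V) => q i) (by
        rintro ⟨i, hi⟩ ⟨j, hj⟩
        have hij : i = j ∨ G.Adj i j := by
          by_cases h : i = j
          exacts [Or.inl h, Or.inr (hcl hi hj h)]
        exact (hr i hi.2 j hj.2 hij).trans (hq i hi.1 j hj.1 hij).symm)
    let w : V → EuclideanSpace ℝ V := fun i => if i ∈ A then q i else U (r i)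
    have hwA : ∀ i ∈ A, w i = q i := fun i hi => if_pos hi
    have hwB : ∀ i ∈ B, w i = U (r i) := by
      intro i hi
      by_cases hiA : i ∈ A
      · rw [hwA i hiA]; exact (hU ⟨i, hiA, hi⟩).symm
      · exact if_neg hiA
    have hBB : ∀ i ∈ B, ∀ j ∈ B, i = j ∨ G.Adj i j → ⟪w i, w j⟫ = a i j := by
      intro i hi j hj hij
      rw [hwB i hi, hwB j hj, U.inner_map_map, hr i hi j hj hij]
    refine ⟨w, fun i hi j hj hij => ?_⟩
    rw [← hAB] at hi hj
    by_cases hiA : i ∈ A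
    · by_cases hjA : j ∈ A
      · rw [hwA i hiA, hwA j hjA, hq i hiA j hjA hij]
      have hjB := hj.resolve_left hjA
      by_cases hiB : i ∈ B
      · exact hBB i hiB j hjB hij
      rcases hij with rfl | hij
      · exact absurd hiA hjA
      · exact absurd hij (hno i hiA j hjB hjA hiB)
    have hiB := hi.resolve_left hiA
    by_cases hjB : j ∈ B
    · exact hBB i hiB j hjB hij
    have hjA := hj.resolve_right hjB
    rcases hij with rfl | hij
    · exact absurd hjA hiA
    · exact absurd hij.symm (hno j hjA i hiB hiA hjB)

/-! ### Universal rigidity, clique stresses and the chordal direction. -/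

section Placement

variable {V : Type*} {G : SimpleGraph V} {d : ℕ}

/-- The coordinate vectors `i ↦ ⟪p i, y⟫` of a placement. -/
noncomputable def SphericalPlacement.rowMap (p : SphericalPlacement V d) :
    EuclideanSpace ℝ (Fin d) →ₗ[ℝ] (V → ℝ) :=
  LinearMap.pi fun i => (innerₛₗ ℝ (p.pos i))

@[simp]
theorem SphericalPlacement.rowMap_apply (p : SphericalPlacement V d)
    (y : EuclideanSpace ℝ (Fin d)) (i : V) : p.rowMap y i = ⟪p.pos i, y⟫ := rfl

theorem SphericalPlacement.eq_zero_of_inner_eq_zero (p : SphericalPlacement V d)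
    {y : EuclideanSpace ℝ (Fin d)} (h : ∀ i, ⟪p.pos i, y⟫ = 0) : y = 0 := by
  have : y ∈ (Submodule.span ℝ (Set.range p.pos))ᗮ := by
    rw [Submodule.mem_orthogonal]
    intro u hu
    induction hu using Submodule.span_induction with
    | mem x hx => obtain ⟨i, rfl⟩ := hx; exact h i
    | zero => simp
    | add x z _ _ hx hz => rw [inner_add_left, hx, hz, add_zero]
    | smul a x _ hx => rw [inner_smul_left, hx, mul_zero]
  rwa [p.span_pos, Submodule.top_orthogonal_eq_bot, Submodule.mem_bot] at this

theorem SphericalPlacement.rowMap_injective (p : SphericalPlacement V d) :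
    Function.Injective p.rowMap := by
  rw [injective_iff_map_eq_zero]
  intro y hy
  exact p.eq_zero_of_inner_eq_zero fun i => congrFun hy i

theorem SphericalPlacement.finrank_range_rowMap (p : SphericalPlacement V d) :
    Module.finrank ℝ (LinearMap.range p.rowMap) = d := by
  rw [LinearMap.finrank_range_of_inj p.rowMap_injective, finrank_euclideanSpace_fin]

/-- A positive operator gives a positive semidefinite matrix on every family of vectors. -/
theorem posSemidef_of_inner_apply [Fintype V] {E : Type*} [NormedAddCommGroup E] [InnerProductSpace ℝ E]
    (T : E →ₗ[ℝ] E) (hs : ∀ x y, ⟪x, T y⟫ = ⟪y, T x⟫) (hT : ∀ x, 0 ≤ ⟪x, T x⟫) (q : V → E) :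
    (Matrix.of fun i j => ⟪q i, T (q j)⟫).PosSemidef := by
  refine Matrix.PosSemidef.of_dotProduct_mulVec_nonneg ?_ fun x => ?_
  · ext i j
    simpa using hs _ _
  · have : star x ⬝ᵥ (Matrix.of fun i j => ⟪q i, T (q j)⟫).mulVec x
        = ⟪∑ i, x i • q i, T (∑ i, x i • q i)⟫ := by
      simp only [dotProduct, Matrix.mulVec, map_sum, map_smul, sum_inner, inner_sum,
        inner_smul_left, inner_smul_right, Matrix.of_apply, Finset.mul_sum]
      refine Finset.sum_congr rfl fun i _ => Finset.sum_congr rfl fun j _ => ?_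
      rw [hs (q i)]
      simp only [Pi.star_apply, star_trivial, conj_trivial]
      ring
    rw [this]
    exact hT _

/-- Uniqueness of the completion in terms of vectors. -/
theorem IsUniversallyRigid.inner_eq {p : SphericalPlacement V d} (hp : IsUniversallyRigid G p)
    [Finite V] {F : Type*} [NormedAddCommGroup F] [InnerProductSpace ℝ F] (w : V → F)
    (h1 : ∀ i, ⟪w i, w i⟫ = 1) (h2 : ∀ i j, G.Adj i j → ⟪w i, w j⟫ = ⟪p.pos i, p.pos j⟫) (i j : V) :
    ⟪w i, w j⟫ = ⟪p.pos i, p.pos j⟫ := by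
  have h := (hp (Matrix.gram ℝ w)).1 ⟨Matrix.posSemidef_gram ℝ w, h1, h2⟩
  exact congrFun (congrFun h i) j

/-- If S violates the conic condition, the matrix of all `⟪p i, (I + εS) p j⟫` has the same
prescribed entries and is positive semidefinite for small ε. Uniqueness makes S vanish on all pairs
of points, and the points span. -/
theorem IsUniversallyRigid.isConicFree [Fintype V] {p : SphericalPlacement V d}
    (hp : IsUniversallyRigid G p) : IsConicFree G p := by
  classical
  intro S hS hv he
  let T := Matrix.toEuclideanLin S
  have hT : ∀ x y : EuclideanSpace ℝ (Fin d), ⟪x, T y⟫ = x.ofLp ⬝ᵥ S.mulVec y.ofLp := by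
    intro x y
    simp [T, PiLp.inner_apply, dotProduct, Matrix.toLpLin_apply, mul_comm]
  have hsymm : ∀ x y : EuclideanSpace ℝ (Fin d), ⟪x, T y⟫ = ⟪y, T x⟫ := by
    intro x y
    rw [hT, hT, Matrix.dotProduct_mulVec, ← Matrix.mulVec_transpose, hS.eq, dotProduct_comm]
  let C := ‖LinearMap.toContinuousLinearMap T‖
  have hC : 0 ≤ C := norm_nonneg _
  have hbound : ∀ x, -(C * ‖x‖ ^ 2) ≤ ⟪x, T x⟫ := by
    intro x
    have h1 : ‖T x‖ ≤ C * ‖x‖ := (LinearMap.toContinuousLinearMap T).le_opNorm x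
    have h2 := abs_real_inner_le_norm x (T x)
    have h3 := neg_abs_le ⟪x, T x⟫
    nlinarith [norm_nonneg x]
  set ε : ℝ := (C + 1)⁻¹ with hε
  have hε0 : 0 < ε := by positivity
  have hεC : ε * C ≤ 1 := by
    rw [hε, inv_mul_le_iff₀ (by positivity)]
    linarith
  have hpsd := posSemidef_of_inner_apply (LinearMap.id + ε • T)
    (fun x y => by simp [inner_add_right, inner_smul_right, hsymm x y, real_inner_comm x y])
    (fun x => by
      have := hbound x
      simp only [LinearMap.add_apply, LinearMap.id_apply, LinearMap.smul_apply, inner_add_right,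
        inner_smul_right, real_inner_self_eq_norm_sq]
      nlinarith [sq_nonneg ‖x‖]) p.pos
  have hX := (hp _).1 ⟨hpsd, fun i => by
      simp [inner_add_right, inner_smul_right, hT, hv i, p.norm_pos], fun i j hij => by
      simp [inner_add_right, inner_smul_right, hT, he i j hij, Matrix.gram_apply]⟩
  have hz : ∀ i j, ⟪p.pos i, T (p.pos j)⟫ = 0 := by
    intro i j
    have := congrFun (congrFun hX i) j
    simp only [Matrix.of_apply, LinearMap.add_apply, LinearMap.id_apply, LinearMap.smul_apply,
      inner_add_right, inner_smul_right, Matrix.gram_apply, add_eq_left, mul_eq_zero, hε0.ne',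
      false_or] at this
    exact this
  have hT0 : T = 0 := by
    ext1 y
    refine p.eq_zero_of_inner_eq_zero fun i => ?_
    rw [hsymm, p.eq_zero_of_inner_eq_zero (fun j => hz j i), inner_zero_right]
  exact (LinearEquiv.map_eq_zero_iff _).1 hT0

/-- In a chordal universally rigid framework, a vector that is locally a coordinate vector on
every clique is one globally. -/
theorem IsUniversallyRigid.mem_range_rowMap [Fintype V] (hG : IsChordalGraph G) {p : SphericalPlacement V d}
    (hp : IsUniversallyRigid G p) {v : V → ℝ}
    (hv : ∀ K : Set V, G.IsClique K → ∃ y, ∀ i ∈ K, v i = ⟪p.pos i, y⟫) :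
    v ∈ LinearMap.range p.rowMap := by
  classical
  have hv' : ∀ K : Set V, ∃ y, G.IsClique K → ∀ i ∈ K, v i = ⟪p.pos i, y⟫ := by
    intro K
    by_cases hK : G.IsClique K
    · obtain ⟨y, hy⟩ := hv K hK
      exact ⟨y, fun _ => hy⟩
    · exact ⟨0, fun h => absurd h hK⟩
  choose y hy using hv'
  -- One bound for all the `y K`, so that a single ε keeps I - ε y yᵀ positive semidefinite for
  -- every clique.
  set B : ℝ := ∑ K, ‖y K‖ ^ 2 with hB
  have hyB : ∀ K, ‖y K‖ ^ 2 ≤ B := fun K =>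
    Finset.single_le_sum (f := fun K => ‖y K‖ ^ 2) (fun _ _ => sq_nonneg _) (Finset.mem_univ K)
  have hB0 : 0 ≤ B := Finset.sum_nonneg fun _ _ => sq_nonneg _
  set ε : ℝ := (B + 1)⁻¹ with hε
  have hε0 : 0 < ε := by positivity
  have hεB : ε * B ≤ 1 := by
    rw [hε, inv_mul_le_iff₀ (by positivity)]
    linarith
  obtain ⟨w, hw1, hw2⟩ := hG.exists_completion
    (fun i j => ⟪p.pos i, p.pos j⟫ - ε * (v i * v j)) (by
      intro K hK
      let T : EuclideanSpace ℝ (Fin d) →ₗ[ℝ] EuclideanSpace ℝ (Fin d) :=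
        LinearMap.id - ε • (innerₛₗ ℝ (y K)).smulRight (y K)
      have hT : ∀ x z, ⟪x, T z⟫ = ⟪x, z⟫ - ε * (⟪x, y K⟫ * ⟪z, y K⟫) := by
        intro x z
        simp only [T, LinearMap.sub_apply, LinearMap.id_apply, LinearMap.smul_apply,
          LinearMap.smulRight_apply, inner_sub_right, inner_smul_right, innerₛₗ_apply_apply,
          real_inner_comm z (y K)]
        ring
      obtain ⟨u, hu⟩ := (posSemidef_of_inner_apply T
        (fun x z => by rw [hT, hT, real_inner_comm]; ring)
        (fun x => by
          rw [hT, real_inner_self_eq_norm_sq]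
          have h1 : ⟪x, y K⟫ * ⟪x, y K⟫ ≤ ‖x‖ ^ 2 * ‖y K‖ ^ 2 := by
            have := real_inner_mul_inner_self_le x (y K)
            rwa [real_inner_self_eq_norm_sq, real_inner_self_eq_norm_sq] at this
          have h2 : ‖x‖ ^ 2 * ‖y K‖ ^ 2 ≤ ‖x‖ ^ 2 * B :=
            mul_le_mul_of_nonneg_left (hyB K) (sq_nonneg _)
          have h3 : ε * (⟪x, y K⟫ * ⟪x, y K⟫) ≤ ε * (‖x‖ ^ 2 * B) :=
            mul_le_mul_of_nonneg_left (h1.trans h2) hε0.le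
          nlinarith [mul_le_mul_of_nonneg_left hεB (sq_nonneg ‖x‖)]) p.pos).exists_inner_eq
      refine ⟨u, fun i hi j hj => ?_⟩
      rw [hu, Matrix.of_apply, hT, hy K hK i hi, hy K hK j hj])
  -- The extra coordinate √ε v restores the subtracted term, so `q` realizes the original edge data
  -- and must have the Gram matrix of `p`.
  let q : V → WithLp 2 (EuclideanSpace ℝ V × ℝ) := fun i => WithLp.toLp 2 (w i, √ε * v i)
  have hq : ∀ i j, ⟪q i, q j⟫ = ⟪w i, w j⟫ + ε * (v i * v j) := by
    intro i j
    simp only [q, WithLp.prod_inner_apply, RCLike.inner_apply, conj_trivial]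
    have := Real.mul_self_sqrt hε0.le
    linear_combination (v i * v j) * this
  have hqp := hp.inner_eq q
    (fun i => by rw [hq, hw1, real_inner_self_eq_norm_sq, p.norm_pos]; ring)
    (fun i j hij => by rw [hq, hw2 i j hij]; ring)
  -- Equal Gram matrices mean equal linear relations; read in the last coordinate of `q`, each
  -- relation among the points of `p` also holds for v.
  obtain ⟨L, hL⟩ := LinearMap.exists_apply_eq_of_relations (K := ℝ) p.pos v (by
    intro c hc
    have h0 : ∑ i, c i • q i = 0 := by
      rw [← norm_eq_zero, norm_sum_smul_eq_of_inner_eq hqp, hc, norm_zero]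
    have h1 := congrArg (fun z : WithLp 2 (EuclideanSpace ℝ V × ℝ) => (WithLp.ofLp z).2) h0
    simp only [q, WithLp.ofLp_sum, Prod.snd_sum, WithLp.ofLp_smul, Prod.smul_snd,
      WithLp.ofLp_zero, Prod.snd_zero, smul_eq_mul] at h1
    have h2 : √ε * ∑ i, c i * v i = 0 := by
      rw [Finset.mul_sum, ← h1]
      exact Finset.sum_congr rfl fun i _ => by ring
    simpa using (mul_eq_zero.1 h2).resolve_left (Real.sqrt_pos.2 hε0).ne')
  refine ⟨(InnerProductSpace.toDual ℝ _).symm (LinearMap.toContinuousLinearMap L), ?_⟩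
  ext i
  rw [p.rowMap_apply, real_inner_comm, InnerProductSpace.toDual_symm_apply]
  exact hL i

/-- The vectors that are coordinate vectors of `p` on `K`. -/
noncomputable def SphericalPlacement.localRows [Fintype V] (p : SphericalPlacement V d) (K : Set V) :
    Submodule ℝ (EuclideanSpace ℝ V) where
  carrier := {v | ∃ y, ∀ i ∈ K, v i = ⟪p.pos i, y⟫}
  add_mem' := by
    rintro a b ⟨y, hy⟩ ⟨z, hz⟩
    exact ⟨y + z, fun i hi => by rw [inner_add_right, ← hy i hi, ← hz i hi]; rfl⟩
  zero_mem' := ⟨0, fun i _ => by simp⟩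
  smul_mem' := by
    rintro c a ⟨y, hy⟩
    exact ⟨c • y, fun i hi => by rw [inner_smul_right, ← hy i hi]; rfl⟩

/-- The matrix of the orthogonal projection onto the annihilator of the local coordinate
vectors. -/
noncomputable def SphericalPlacement.localStress [Fintype V] [DecidableEq V] (p : SphericalPlacement V d)
    (K : Set V) : Matrix V V ℝ :=
  Matrix.gram ℝ fun j => (p.localRows K)ᗮ.starProjection (EuclideanSpace.single j (1 : ℝ))

theorem SphericalPlacement.posSemidef_localStress [Fintype V] [DecidableEq V]
    (p : SphericalPlacement V d) (K : Set V) : (p.localStress K).PosSemidef :=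
  Matrix.posSemidef_gram ℝ _

/-- For i outside K the basis vector at i vanishes on K, so it is a local coordinate vector (with y
= 0) and is projected to zero. -/
theorem SphericalPlacement.localStress_apply_eq_zero [Fintype V] [DecidableEq V] (p : SphericalPlacement V d)
    {K : Set V} {i : V} (hi : i ∉ K) (j : V) : p.localStress K i j = 0 := by
  have h : EuclideanSpace.single i (1 : ℝ) ∈ p.localRows K :=
    ⟨0, fun k hk => by
      have : k ≠ i := fun h => hi (h ▸ hk)
      simp [this]⟩
  have h0 : (p.localRows K)ᗮ.starProjection (EuclideanSpace.single i (1 : ℝ)) = 0 :=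
    (Submodule.starProjection_apply_eq_zero_iff _).2 ((p.localRows K).le_orthogonal_orthogonal h)
  rw [localStress, Matrix.gram_apply, h0, inner_zero_left]

theorem SphericalPlacement.sum_smul_starProjection [Fintype V] [DecidableEq V] (p : SphericalPlacement V d)
    (K : Set V) (x : V → ℝ) :
    ∑ j, x j • (p.localRows K)ᗮ.starProjection (EuclideanSpace.single j (1 : ℝ)) =
      (p.localRows K)ᗮ.starProjection (WithLp.toLp 2 x) := by
  simp only [← map_smul, ← map_sum]
  congr 1
  ext i
  simp [Pi.single_apply]

/-- The quadratic form at x is the squared length of the projection of x, and the double orthogonal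
complement is the subspace itself. -/
theorem SphericalPlacement.mulVec_localStress_eq_zero_iff [Fintype V] [DecidableEq V]
    (p : SphericalPlacement V d) (K : Set V) (x : V → ℝ) :
    (p.localStress K).mulVec x = 0 ↔ WithLp.toLp 2 x ∈ p.localRows K := by
  rw [← (p.posSemidef_localStress K).dotProduct_mulVec_zero_iff, localStress,
    Matrix.star_dotProduct_gram_mulVec,
    p.sum_smul_starProjection, inner_self_eq_zero, Submodule.starProjection_apply_eq_zero_iff,
    Submodule.orthogonal_orthogonal]

open Classical in
/-- The sum of the local stress matrices over all cliques. -/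
noncomputable def SphericalPlacement.cliqueStress [Fintype V] (p : SphericalPlacement V d)
    (G : SimpleGraph V) : Matrix V V ℝ :=
  ∑ K with G.IsClique K, p.localStress K

theorem SphericalPlacement.posSemidef_cliqueStress [Fintype V] (p : SphericalPlacement V d) :
    (p.cliqueStress G).PosSemidef := by
  classical
  exact Matrix.posSemidef_sum _ fun K _ => p.posSemidef_localStress K

/-- No clique contains two distinct non-adjacent vertices, so every summand vanishes at this entry.
-/
theorem SphericalPlacement.cliqueStress_apply_eq_zero [Fintype V] (p : SphericalPlacement V d) {i j : V}
    (hij : i ≠ j) (h : ¬ G.Adj i j) : p.cliqueStress G i j = 0 := by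
  classical
  rw [cliqueStress, Matrix.sum_apply]
  refine Finset.sum_eq_zero fun K hK => ?_
  have hK : G.IsClique K := by simpa using hK
  by_cases hi : i ∈ K
  · have hj : j ∉ K := fun hj => h (hK hi hj hij)
    rw [← (p.posSemidef_localStress K).isHermitian.apply]
    exact congrArg star (p.localStress_apply_eq_zero hj i)
  · exact p.localStress_apply_eq_zero hi j

/-- The kernel of a sum of positive semidefinite matrices is the intersection of their kernels. -/
theorem SphericalPlacement.mulVec_cliqueStress_eq_zero_iff [Fintype V] (p : SphericalPlacement V d)
    (x : V → ℝ) : (p.cliqueStress G).mulVec x = 0 ↔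
      ∀ K : Set V, G.IsClique K → ∃ y, ∀ i ∈ K, x i = ⟪p.pos i, y⟫ := by
  classical
  have h : (p.cliqueStress G).mulVec x = 0 ↔
      ∀ K : Set V, G.IsClique K → (p.localStress K).mulVec x = 0 := by
    constructor
    · intro h K hK
      have h0 : ∑ K with G.IsClique K, star x ⬝ᵥ (p.localStress K).mulVec x = 0 := by
        rw [← dotProduct_sum, ← Matrix.sum_mulVec]
        exact (congrArg _ h).trans (dotProduct_zero _)
      have h1 := (Finset.sum_eq_zero_iff_of_nonneg (fun K _ =>
        (p.posSemidef_localStress K).dotProduct_mulVec_nonneg x)).1 h0 K (by simpa using hK)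
      exact ((p.posSemidef_localStress K).dotProduct_mulVec_zero_iff x).1 h1
    · intro h
      rw [cliqueStress, Matrix.sum_mulVec]
      exact Finset.sum_eq_zero fun K hK => h K (by simpa using hK)
  rw [h]
  exact forall₂_congr fun K _ => p.mulVec_localStress_eq_zero_iff K x

/-- The stress with a given symmetric matrix supported on the graph. -/
def SphericalStress.ofMatrix (G : SimpleGraph V) (M : Matrix V V ℝ) (hM : M.IsSymm) :
    SphericalStress G where
  vertex i := M i i
  edge e := Sym2.lift ⟨fun i j => M i j, fun i j => hM.apply j i⟩ e.1

theorem SphericalStress.toMatrix_ofMatrix {M : Matrix V V ℝ} (hM : M.IsSymm)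
    (h : ∀ i j, i ≠ j → ¬ G.Adj i j → M i j = 0) : (ofMatrix G M hM).toMatrix = M := by
  ext i j
  rw [toMatrix, Matrix.of_apply]
  split_ifs with hij
  · subst hij; rfl
  · rw [weight]
    split_ifs with hadj
    · rfl
    · exact (h i j hij hadj).symm

theorem SphericalStress.sum_toMatrix_smul [Fintype V] (ω : SphericalStress G) (p : SphericalPlacement V d)
    (i : V) : ∑ j, ω.toMatrix i j • p.pos j =
      ω.vertex i • p.pos i + ∑ j, ω.weight i j • p.pos j := by
  classical
  have hw : ω.weight i i = 0 := by simp [weight]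
  rw [← Finset.add_sum_erase _ _ (Finset.mem_univ i),
    ← Finset.add_sum_erase _ (fun j => ω.weight i j • p.pos j) (Finset.mem_univ i), hw, zero_smul,
    zero_add]
  congr 1
  · simp [toMatrix]
  · refine Finset.sum_congr rfl fun j hj => ?_
    have : i ≠ j := (Finset.ne_of_mem_erase hj).symm
    simp [toMatrix, this]

/-- Equilibrium means that the stress matrix annihilates the coordinate vectors. -/
theorem SphericalStress.isEquilibrium_iff [Fintype V] (ω : SphericalStress G) (p : SphericalPlacement V d) :
    ω.IsEquilibrium p ↔ LinearMap.range p.rowMap ≤ LinearMap.ker ω.toMatrix.mulVecLin := by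
  have key : ∀ y i, ω.toMatrix.mulVec (p.rowMap y) i = ⟪∑ j, ω.toMatrix i j • p.pos j, y⟫ := by
    intro y i
    simp [Matrix.mulVec, dotProduct, sum_inner, inner_smul_left]
  constructor
  · rintro h _ ⟨y, rfl⟩
    rw [LinearMap.mem_ker, Matrix.mulVecLin_apply]
    ext i
    rw [key, ω.sum_toMatrix_smul, h i, inner_zero_left]
    rfl
  · intro h i
    rw [← ω.sum_toMatrix_smul p i]
    have hk : ⟪∑ j, ω.toMatrix i j • p.pos j, ∑ j, ω.toMatrix i j • p.pos j⟫ = 0 := by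
      rw [← key]
      exact congrFun (h ⟨_, rfl⟩) i
    exact inner_self_eq_zero.1 hk

theorem IsUniversallyRigid.isSuperStable [Fintype V] (hG : IsChordalGraph G) {p : SphericalPlacement V d}
    (hp : IsUniversallyRigid G p) : IsSuperStable G p := by
  refine ⟨?_, hp.isConicFree⟩
  have hpsd := p.posSemidef_cliqueStress (G := G)
  have hM : (SphericalStress.ofMatrix G (p.cliqueStress G) hpsd.isHermitian).toMatrix =
      p.cliqueStress G :=
    SphericalStress.toMatrix_ofMatrix _ fun i j hij h => p.cliqueStress_apply_eq_zero hij h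
  have hker : LinearMap.ker (p.cliqueStress G).mulVecLin = LinearMap.range p.rowMap := by
    ext x
    rw [LinearMap.mem_ker, Matrix.mulVecLin_apply, p.mulVec_cliqueStress_eq_zero_iff]
    constructor
    · exact hp.mem_range_rowMap hG
    · rintro ⟨y, rfl⟩ K _
      exact ⟨y, fun i _ => rfl⟩
  refine ⟨_, (SphericalStress.isEquilibrium_iff _ p).2 ?_, hM.symm ▸ hpsd, ?_⟩
  · rw [hM, hker]
  · rw [hM, hker, p.finrank_range_rowMap]

end Placement

/-! ### Frameworks on simplex points: rigidity and failure of super stability. -/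

section Coloring

variable {V C : Type*}

/-- The edges of `G` joining vertices of the same color. -/
def SimpleGraph.monochromatic (G : SimpleGraph V) (c : V → C) : SimpleGraph V where
  Adj i j := G.Adj i j ∧ c i = c j
  symm.symm := fun _ _ h => ⟨h.1.symm, h.2.symm⟩
  loopless.irrefl := fun _ h => h.1.ne rfl

theorem SimpleGraph.Reachable.color_eq {G : SimpleGraph V} {c : V → C} {i j : V}
    (h : (G.monochromatic c).Reachable i j) : c i = c j :=
  SimpleGraph.Reachable.preserves (G := G.monochromatic c) (P := fun x => c i = c x)
    (fun _ _ hxy hx => hx.trans hxy.2) h rfl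

theorem SimpleGraph.monochromatic_comp_le {D : Type*} (G : SimpleGraph V) (c : V → C)
    (g : C → D) : G.monochromatic c ≤ G.monochromatic (g ∘ c) :=
  fun _ _ h => ⟨h.1, congrArg g h.2⟩

variable {d : ℕ}

/-- The standard basis vectors, together with the unit vector in direction `(1, …, 1)`. -/
noncomputable def simplexPoint (d : ℕ) : Option (Fin d) → EuclideanSpace ℝ (Fin d)
  | some j => EuclideanSpace.single j 1
  | none => WithLp.toLp 2 fun _ => (√(d : ℝ))⁻¹

theorem sum_inv_sqrt_mul_self (hd : 0 < d) :
    ∑ _j : Fin d, (√(d : ℝ))⁻¹ * (√(d : ℝ))⁻¹ = 1 := by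
  have : (d : ℝ) ≠ 0 := by positivity
  rw [Finset.sum_const, Finset.card_univ, Fintype.card_fin, nsmul_eq_mul, ← mul_inv,
    Real.mul_self_sqrt (Nat.cast_nonneg d), mul_inv_cancel₀ this]

theorem norm_simplexPoint (hd : 0 < d) (t : Option (Fin d)) : ‖simplexPoint d t‖ = 1 := by
  cases t with
  | some j => simp [simplexPoint]
  | none =>
    rw [← sq_eq_sq₀ (norm_nonneg _) zero_le_one, ← real_inner_self_eq_norm_sq, one_pow,
      ← sum_inv_sqrt_mul_self hd, PiLp.inner_apply]
    rfl

/-- The placement that puts the vertices at the points given by a coloring. -/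
noncomputable def colorPlacement (hd : 0 < d) (τ : V → Option (Fin d))
    (hτ : ∀ j, ∃ v, τ v = some j) : SphericalPlacement V d where
  pos v := simplexPoint d (τ v)
  norm_pos v := norm_simplexPoint hd (τ v)
  span_pos := by
    rw [eq_top_iff, ← (EuclideanSpace.basisFun (Fin d) ℝ).toBasis.span_eq]
    refine Submodule.span_mono ?_
    rintro _ ⟨j, rfl⟩
    obtain ⟨v, hv⟩ := hτ j
    exact ⟨v, by simp [hv, simplexPoint]⟩

/-- In any completion, monochromatic edges force equal vectors, edges between basis classes force
orthonormality, and a `none` component attached to every basis class is forced to the normalized sum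
of the basis. -/
theorem colorPlacement_isUniversallyRigid [Fintype V] {G : SimpleGraph V} (hd : 0 < d)
    (τ : V → Option (Fin d)) (hτ : ∀ j, ∃ v, τ v = some j)
    (hconn : ∀ i j, τ i = τ j → τ i ≠ none → (G.monochromatic τ).Reachable i j)
    (hedge : ∀ j k, j < k → ∃ u v, τ u = some j ∧ τ v = some k ∧ G.Adj u v)
    (hnone : ∀ v, τ v = none → ∀ j, ∃ w u, (G.monochromatic τ).Reachable v w ∧
      τ u = some j ∧ G.Adj w u) :
    IsUniversallyRigid G (colorPlacement hd τ hτ) := by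
  classical
  set p := colorPlacement hd τ hτ with hp
  have hpos : ∀ v, p.pos v = simplexPoint d (τ v) := fun _ => rfl
  have hself : ∀ v, ⟪p.pos v, p.pos v⟫ = 1 := fun v => by
    rw [real_inner_self_eq_norm_sq, p.norm_pos, one_pow]
  intro X
  constructor
  swap
  · rintro rfl
    exact ⟨Matrix.posSemidef_gram ℝ _, hself, fun _ _ _ => rfl⟩
  rintro ⟨hX, hX1, hXe⟩
  obtain ⟨x, hx⟩ := hX.exists_inner_eq
  have hx1 : ∀ i, ‖x i‖ = 1 := fun i => by
    rw [← sq_eq_sq₀ (norm_nonneg _) zero_le_one, ← real_inner_self_eq_norm_sq, hx, hX1, one_pow]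
  have hxe : ∀ i j, G.Adj i j → ⟪x i, x j⟫ = ⟪p.pos i, p.pos j⟫ := fun i j hij => by
    rw [hx, hXe i j hij, Matrix.gram_apply]
  have hmono : ∀ i j, (G.monochromatic τ).Reachable i j → x i = x j := by
    intro i j hij
    refine hij.preserves (P := fun k => x i = x k) (fun a b hab ha => ha.trans ?_) rfl
    rw [← inner_eq_one_iff_of_norm_eq_one (𝕜 := ℝ) (hx1 a) (hx1 b), hxe a b hab.1, hpos a, hab.2,
      ← hpos, hself]
  have hτ' := hτ
  choose r hr using hτ'
  let z : Fin d → EuclideanSpace ℝ V := fun j => x (r j)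
  have hz : ∀ i j, τ i = some j → x i = z j := fun i j hi =>
    hmono _ _ (hconn i (r j) (hi.trans (hr j).symm) (by simp [hi]))
  have horth : Orthonormal ℝ z := by
    have hlt : ∀ j k, j < k → ⟪z j, z k⟫ = 0 := by
      intro j k hjk
      obtain ⟨u, v, hu, hv, huv⟩ := hedge j k hjk
      rw [← hz u j hu, ← hz v k hv, hxe u v huv, hpos, hpos, hu, hv]
      simp [simplexPoint, EuclideanSpace.inner_single_left, hjk.ne]
    refine ⟨fun j => hx1 _, fun j k hjk => ?_⟩
    rcases lt_or_gt_of_ne hjk with h | h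
    · exact hlt j k h
    · exact (real_inner_comm _ _).trans (hlt k j h)
  have hrep : ∀ i, x i = ∑ j, simplexPoint d (τ i) j • z j := by
    intro i
    cases hi : τ i with
    | some j =>
      rw [hz i j hi, Finset.sum_eq_single j]
      · simp [simplexPoint]
      · intro k _ hk; simp [simplexPoint, hk]
      · simp
    | none =>
      have hzi : ∀ j, ⟪x i, z j⟫ = (√(d : ℝ))⁻¹ := by
        intro j
        obtain ⟨w, u, hw, hu, hwu⟩ := hnone i hi j
        rw [hmono i w hw, ← hz u j hu, hxe w u hwu, hpos, hpos, hu, ← hw.color_eq, hi]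
        simp [simplexPoint, EuclideanSpace.inner_single_right]
      have hn : ‖∑ j, simplexPoint d none j • z j‖ = 1 := by
        rw [← sq_eq_sq₀ (norm_nonneg _) zero_le_one, ← real_inner_self_eq_norm_sq,
          horth.inner_sum, one_pow, ← sum_inv_sqrt_mul_self hd]
        rfl
      -- Equality in Cauchy–Schwarz: both vectors are unit, and their inner product is d · (1/√d)² =
      -- 1.
      rw [← inner_eq_one_iff_of_norm_eq_one (𝕜 := ℝ) (hx1 i) hn, inner_sum,
        ← sum_inv_sqrt_mul_self hd]
      refine Finset.sum_congr rfl fun j _ => ?_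
      rw [inner_smul_right, hzi]
      rfl
  ext i j
  rw [← hx, hrep i, hrep j, horth.inner_sum, Matrix.gram_apply, PiLp.inner_apply]
  refine Finset.sum_congr rfl fun k _ => ?_
  rw [hpos, hpos]
  simp [mul_comm]

theorem SphericalStress.toMatrix_apply_eq_zero {G : SimpleGraph V} (ω : SphericalStress G)
    {i j : V} (hij : i ≠ j) (h : ¬ G.Adj i j) : ω.toMatrix i j = 0 := by
  simp [toMatrix, weight, hij, h]

/-- A stress of corank d has only coordinate vectors in its kernel. Equilibrium makes Ω act on all
class indicators as multiples of one vector, so a class not adjacent to i forces the entry at i to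
vanish. Letting that class depend on whether i lies in `Z` puts the indicator of class `j₀` in the
kernel, although it is not a coordinate vector. -/
theorem colorPlacement_not_isSuperStable [Fintype V] {G : SimpleGraph V} (hd : 0 < d)
    (τ : V → Option (Fin d)) (hτ : ∀ j, ∃ v, τ v = some j) {v₀ : V} (hv₀ : τ v₀ = none)
    (j₀ : Fin d) (Z : Set V) {c₁ c₂ : Option (Fin d)} (hc₁ : c₁ ≠ some j₀) (hc₂ : c₂ ≠ some j₀)
    (h₁ : ∀ i u, τ i = some j₀ → i ∈ Z → G.Adj i u → τ u ≠ c₁)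
    (h₂ : ∀ i u, τ i = some j₀ → i ∉ Z → G.Adj i u → τ u ≠ c₂) :
    ¬ IsSuperStable G (colorPlacement hd τ hτ) := by
  classical
  set p := colorPlacement hd τ hτ with hp
  have hpos : ∀ v, p.pos v = simplexPoint d (τ v) := fun _ => rfl
  rintro ⟨⟨ω, heq, hpsd, hrank⟩, -⟩
  set Ω := ω.toMatrix with hΩ
  have hle := (ω.isEquilibrium_iff p).1 heq
  have hker : LinearMap.range p.rowMap = LinearMap.ker Ω.mulVecLin :=
    Submodule.eq_of_le_of_finrank_eq hle (by rw [p.finrank_range_rowMap, hrank])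
  let ind : Option (Fin d) → V → ℝ := fun c v => if τ v = c then 1 else 0
  set s : ℝ := (√(d : ℝ))⁻¹ with hs
  have hs0 : s ≠ 0 := by
    rw [hs]
    positivity
  have hrel : ∀ j, Ω.mulVec (ind (some j)) = -s • Ω.mulVec (ind none) := by
    intro j
    -- The j-th coordinate vector is 1 on class j and 1/√d on the `none` vertices.
    have h : ind (some j) + s • ind none = p.rowMap (EuclideanSpace.single j 1) := by
      ext i
      rw [p.rowMap_apply, hpos]
      cases hi : τ i with
      | none => simp [ind, hi, simplexPoint, EuclideanSpace.inner_single_right, hs]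
      | some k =>
        by_cases hk : k = j
        · subst hk; simp [ind, hi, simplexPoint]
        · simp [ind, hi, simplexPoint, EuclideanSpace.inner_single_right, hk, Ne.symm hk]
    have h0 : Ω.mulVec (ind (some j) + s • ind none) = 0 := by
      rw [h]
      exact hle ⟨_, rfl⟩
    rw [Matrix.mulVec_add, Matrix.mulVec_smul] at h0
    rw [neg_smul]
    exact eq_neg_of_add_eq_zero_left h0
  have hvanish : ∀ i c, τ i = some j₀ → c ≠ some j₀ → (∀ u, G.Adj i u → τ u ≠ c) →
      Ω.mulVec (ind (some j₀)) i = 0 := by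
    intro i c hi hc hu
    have hzero : Ω.mulVec (ind c) i = 0 := by
      refine Finset.sum_eq_zero fun u _ => ?_
      by_cases huc : τ u = c
      · have hiu : i ≠ u := by
          rintro rfl
          exact hc (huc.symm.trans hi)
        exact mul_eq_zero_of_left (ω.toMatrix_apply_eq_zero hiu fun h => hu u h huc) _
      · simp [ind, huc]
    rw [hrel]
    cases c with
    | none => rw [Pi.smul_apply, hzero, smul_zero]
    | some j => rwa [hrel] at hzero
  have hmem : Ω.mulVec (ind (some j₀)) = 0 := by
    rw [← hpsd.dotProduct_mulVec_zero_iff]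
    refine Finset.sum_eq_zero fun i _ => ?_
    by_cases hi : τ i = some j₀
    · by_cases hZ : i ∈ Z
      · rw [hvanish i c₁ hi hc₁ fun u hu => h₁ i u hi hZ hu, mul_zero]
      · rw [hvanish i c₂ hi hc₂ fun u hu => h₂ i u hi hZ hu, mul_zero]
    · simp [ind, hi]
  obtain ⟨y, hy⟩ : ind (some j₀) ∈ LinearMap.range p.rowMap := by
    rw [hker]
    exact hmem
  -- The basis classes force y to be the basis vector at `j₀`; its value at `v₀` would then be 1/√d
  -- instead of 0.
  have hyj : ∀ j, y j = if j = j₀ then 1 else 0 := by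
    intro j
    obtain ⟨v, hv⟩ := hτ j
    have := congrFun hy v
    rw [p.rowMap_apply, hpos, hv] at this
    simpa [simplexPoint, EuclideanSpace.inner_single_left, ind, hv] using this
  have := congrFun hy v₀
  rw [p.rowMap_apply, hpos, hv₀] at this
  simp [simplexPoint, PiLp.inner_apply, ind, hv₀, hyj, ← hs, hs0] at this

end Coloring

/-! ### Partial colorings that contract to a four-cycle. -/

section CyclePattern

variable {V : Type*} {G : SimpleGraph V} {c : V → Option (Fin 4)}

/-- A partial coloring whose four color classes are connected and contract to a four-cycle. -/
structure IsCyclePattern (G : SimpleGraph V) (c : V → Option (Fin 4)) : Prop where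
  reachable : ∀ i j, c i = c j → c i ≠ none → (G.monochromatic c).Reachable i j
  exists_adj : ∀ k, ∃ u v, c u = some k ∧ c v = some (k + 1) ∧ G.Adj u v
  not_adj : ∀ k u v, c u = some k → c v = some (k + 2) → ¬ G.Adj u v

theorem Fin.eq_add_cases_four : ∀ k l : Fin 4, l = k ∨ l = k + 1 ∨ l = k + 2 ∨ l = k + 3 := by
  decide

theorem Fin.add_two_add_two_four : ∀ k : Fin 4, k + 2 + 2 = k := by decide

/-- A hole gives a cycle pattern. -/
theorem exists_isCyclePattern_of_hole {n : ℕ} (hn : 4 ≤ n)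
    (e : SimpleGraph.cycleGraph n ↪g G) : ∃ c, IsCyclePattern G c := by
  classical
  -- The first three vertices of the hole get their own colors; the remaining path forms class 3.
  let cl : Fin n → Fin 4 := fun i => ⟨min i.val 3, by omega⟩
  let c : V → Option (Fin 4) := fun v => if h : ∃ i, e i = v then some (cl h.choose) else none
  have hc : ∀ i, c (e i) = some (cl i) := by
    intro i
    have h : ∃ j, e j = e i := ⟨i, rfl⟩
    have : c (e i) = some (cl h.choose) := dif_pos h
    rw [this, e.injective h.choose_spec]
  have hc' : ∀ v k, c v = some k → ∃ i, e i = v ∧ cl i = k := by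
    intro v k hv
    by_cases h : ∃ i, e i = v
    · obtain ⟨i, rfl⟩ := h
      exact ⟨i, rfl, Option.some_injective _ ((hc i).symm.trans hv)⟩
    · have : c v = none := dif_neg h
      rw [this] at hv
      exact absurd hv (by simp)
  have hadj : ∀ i j : Fin n, i.val < j.val → (G.Adj (e i) (e j) ↔
      (j.val = i.val + 1 ∨ (i.val = 0 ∧ j.val = n - 1))) := fun i j hij =>
    e.map_adj_iff.trans (SimpleGraph.cycleGraph_adj_of_lt hij)
  have hval : ∀ i : Fin n, (cl i).val = min i.val 3 := fun _ => rfl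
  have hbase : ∀ m : ℕ, ∀ h : 3 + m < n,
      (G.monochromatic c).Reachable (e ⟨3, by omega⟩) (e ⟨3 + m, h⟩) := by
    intro m
    induction m with
    | zero => exact fun _ => SimpleGraph.Reachable.refl _
    | succ m ih =>
      intro h
      refine (ih (by omega)).trans (SimpleGraph.Adj.reachable ⟨?_, ?_⟩)
      · exact (hadj _ _ (by simp)).2 (Or.inl rfl)
      · rw [hc, hc]
        congr 1
        apply Fin.ext
        rw [hval, hval]
        simp only
        omega
  refine ⟨c, ?_, ?_, ?_⟩
  · intro u v huv hu
    obtain ⟨k, hk⟩ := Option.ne_none_iff_exists'.1 hu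
    obtain ⟨i, rfl, hi⟩ := hc' u k hk
    obtain ⟨j, rfl, hj⟩ := hc' v k (huv ▸ hk)
    have hij : min i.val 3 = min j.val 3 := by rw [← hval, ← hval, hi, hj]
    by_cases hi3 : 3 ≤ i.val
    · have h1 := hbase (i.val - 3) (by omega)
      have h2 := hbase (j.val - 3) (by omega)
      have e1 : (⟨3 + (i.val - 3), by omega⟩ : Fin n) = i := Fin.ext (by simp only; omega)
      have e2 : (⟨3 + (j.val - 3), by omega⟩ : Fin n) = j := Fin.ext (by simp only; omega)
      rw [e1] at h1
      rw [e2] at h2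
      exact h1.symm.trans h2
    · have : i = j := Fin.ext (by omega)
      rw [this]
  · intro k
    have hk := k.isLt
    by_cases h3 : k.val < 3
    · refine ⟨e ⟨k.val, by omega⟩, e ⟨k.val + 1, by omega⟩, ?_, ?_, ?_⟩
      · rw [hc]; congr 1; apply Fin.ext; rw [hval]; simp only; omega
      · rw [hc]; congr 1; apply Fin.ext; rw [hval, Fin.val_add]
        have : ((1 : Fin 4) : ℕ) = 1 := rfl
        simp only [this]
        omega
      · exact (hadj _ _ (by simp)).2 (Or.inl rfl)
    · have hk3 : k = 3 := Fin.ext (by have : ((3 : Fin 4) : ℕ) = 3 := rfl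
                                      omega)
      subst hk3
      refine ⟨e ⟨n - 1, by omega⟩, e ⟨0, by omega⟩, ?_, ?_, ?_⟩
      · rw [hc]; congr 1; apply Fin.ext; rw [hval]
        have : ((3 : Fin 4) : ℕ) = 3 := rfl
        simp only [this]
        omega
      · rw [hc]; rfl
      · exact ((hadj _ _ (by simp only; omega)).2 (Or.inr ⟨rfl, rfl⟩)).symm
  · intro k u v hu hv huv
    obtain ⟨i, rfl, hi⟩ := hc' u k hu
    obtain ⟨j, rfl, hj⟩ := hc' v _ hv
    have h1 := hval i
    have h2 := hval j
    rw [hi] at h1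
    rw [hj, Fin.val_add] at h2
    have h22 : ((2 : Fin 4) : ℕ) = 2 := rfl
    rw [h22] at h2
    rcases lt_trichotomy i.val j.val with h | h | h
    · have := (hadj i j h).1 huv
      omega
    · omega
    · have := (hadj j i h).1 huv.symm
      omega

/-- A vertex attached to one class but not to the opposite one can be added to that class. -/
theorem IsCyclePattern.update [DecidableEq V] (hc : IsCyclePattern G c) {v u : V} {k : Fin 4}
    (hv : c v = none) (hu : c u = some k) (hvu : G.Adj v u)
    (hno : ∀ w, c w = some (k + 2) → ¬ G.Adj v w) :
    IsCyclePattern G (Function.update c v (some k)) := by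
  set c' := Function.update c v (some k) with hc'
  have hc'v : c' v = some k := Function.update_self _ _ _
  have hc'n : ∀ w, w ≠ v → c' w = c w := fun w hw => Function.update_of_ne hw _ _
  have hsome : ∀ w l, c w = some l → c' w = some l := by
    intro w l hw
    rw [hc'n w (by rintro rfl; simp [hv] at hw), hw]
  have hle : ∀ i j, c i ≠ none → (G.monochromatic c).Reachable i j →
      (G.monochromatic c').Reachable i j := by
    intro i j hi hij
    refine (hij.preserves (P := fun x => c x ≠ none ∧ (G.monochromatic c').Reachable i x)
      ?_ ⟨hi, SimpleGraph.Reachable.refl _⟩).2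
    rintro a b hab ⟨ha, har⟩
    obtain ⟨l, hl⟩ := Option.ne_none_iff_exists'.1 ha
    have hbl : c b = some l := hab.2 ▸ hl
    exact ⟨by simp [hbl], har.trans (SimpleGraph.Adj.reachable
      ⟨hab.1, (hsome a l hl).trans (hsome b l hbl).symm⟩)⟩
  have hto : ∀ i, c' i = some k → (G.monochromatic c').Reachable i u := by
    intro i hi
    by_cases hiv : i = v
    · subst hiv
      exact SimpleGraph.Adj.reachable ⟨hvu, hi.trans (hsome u k hu).symm⟩
    · rw [hc'n i hiv] at hi
      exact hle _ _ (by simp [hi]) (hc.reachable i u (hi.trans hu.symm) (by simp [hi]))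
  refine ⟨?_, ?_, ?_⟩
  · intro i j hij hi
    obtain ⟨l, hl⟩ := Option.ne_none_iff_exists'.1 hi
    by_cases hlk : l = k
    · subst hlk
      exact (hto i hl).trans (hto j (hij ▸ hl)).symm
    · have hne : ∀ w, c' w = some l → w ≠ v := by
        rintro w hw rfl
        exact hlk (Option.some_injective _ (hw.symm.trans hc'v))
      have hil := hl
      have hjl : c' j = some l := hij ▸ hl
      rw [hc'n i (hne i hl)] at hil
      rw [hc'n j (hne j hjl)] at hjl
      exact hle _ _ (by simp [hil]) (hc.reachable i j (hil.trans hjl.symm) (by simp [hil]))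
  · intro l
    obtain ⟨a, b, ha, hb, hab⟩ := hc.exists_adj l
    exact ⟨a, b, hsome a _ ha, hsome b _ hb, hab⟩
  · intro l a b ha hb hab
    have key : ∀ x y l, c' x = some l → c' y = some (l + 2) → x = v → ¬ G.Adj x y := by
      rintro x y l hx hy rfl hxy
      have hlk : l = k := Option.some_injective _ (hx.symm.trans hc'v)
      subst hlk
      rw [hc'n y hxy.ne'] at hy
      exact hno y hy hxy
    by_cases hav : a = v
    · exact key a b l ha hb hav hab
    by_cases hbv : b = v
    · exact key b a (l + 2) hb (by rw [Fin.add_two_add_two_four]; exact ha) hbv hab.symm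
    rw [hc'n a hav] at ha
    rw [hc'n b hbv] at hb
    exact hc.not_adj l a b ha hb hab

/-- A maximal cycle pattern: every uncolored vertex attached to a class is attached to the
opposite one. -/
theorem exists_maximal_isCyclePattern [Finite V] (h : ∃ c, IsCyclePattern G c) :
    ∃ c, IsCyclePattern G c ∧ ∀ v u k, c v = none → c u = some k → G.Adj v u →
      ∃ w, c w = some (k + 2) ∧ G.Adj v w := by
  classical
  cases nonempty_fintype V
  -- Maximize the number of colored vertices; a vertex attached to a class but not to its opposite
  -- could still be added.
  obtain ⟨c, hc, hmax⟩ := Finset.exists_max_image (Finset.univ.filter (IsCyclePattern G))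
    (fun c => (Finset.univ.filter fun v => c v ≠ none).card)
    (h.imp fun c hc => by simpa using hc)
  have hc : IsCyclePattern G c := by simpa using hc
  refine ⟨c, hc, fun v u k hv hu hvu => ?_⟩
  by_contra! hno
  have hle := hmax _ (by simpa using hc.update hv hu hvu hno)
  refine absurd hle (not_le.2 (Finset.card_lt_card ?_))
  rw [Finset.ssubset_iff_of_subset]
  · exact ⟨v, by simp, by simp [hv]⟩
  · intro w hw
    have hw : c w ≠ none := by simpa using hw
    have : w ≠ v := by
      rintro rfl
      exact hw hv
    simpa [this] using hw

/-- The component of `v` among the vertices of its color has a neighbor of color `k`. -/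
def Touches (G : SimpleGraph V) (c : V → Option (Fin 4)) (v : V) (k : Fin 4) : Prop :=
  ∃ w u, (G.monochromatic c).Reachable v w ∧ c u = some k ∧ G.Adj w u

theorem Touches.of_reachable {v w : V} {k : Fin 4} (h : (G.monochromatic c).Reachable v w)
    (hw : Touches G c w k) : Touches G c v k := by
  obtain ⟨x, u, hx, hu, hxu⟩ := hw
  exact ⟨x, u, h.trans hx, hu, hxu⟩

/-- A universally rigid framework that is not super stable, on a colored graph. -/
theorem exists_rigid_not_superStable [Fintype V] {d : ℕ} (hd : 0 < d)
    (τ : V → Option (Fin d)) (hτ : ∀ j, ∃ v, τ v = some j)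
    (hconn : ∀ i j, τ i = τ j → τ i ≠ none → (G.monochromatic τ).Reachable i j)
    (hedge : ∀ j k, j < k → ∃ u v, τ u = some j ∧ τ v = some k ∧ G.Adj u v)
    (hnone : ∀ v, τ v = none → ∀ j, ∃ w u, (G.monochromatic τ).Reachable v w ∧
      τ u = some j ∧ G.Adj w u) (hne : ∃ v, τ v = none)
    (j₀ : Fin d) (Z : Set V) {c₁ c₂ : Option (Fin d)} (hc₁ : c₁ ≠ some j₀) (hc₂ : c₂ ≠ some j₀)
    (h₁ : ∀ i u, τ i = some j₀ → i ∈ Z → G.Adj i u → τ u ≠ c₁)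
    (h₂ : ∀ i u, τ i = some j₀ → i ∉ Z → G.Adj i u → τ u ≠ c₂) :
    ∃ (d : ℕ) (p : SphericalPlacement V d), IsUniversallyRigid G p ∧ ¬ IsSuperStable G p := by
  obtain ⟨v₀, hv₀⟩ := hne
  exact ⟨d, colorPlacement hd τ hτ, colorPlacement_isUniversallyRigid hd τ hτ hconn hedge hnone,
    colorPlacement_not_isSuperStable hd τ hτ hv₀ j₀ Z hc₁ hc₂ h₁ h₂⟩

end CyclePattern

/-! ### From a hole to a rigid framework that is not super stable. -/

section Converse

variable {V : Type*} {G : SimpleGraph V} {c : V → Option (Fin 4)}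

/-- This is where connectedness of `G` enters: an edge leaving the uncolored component must end at a
colored vertex. -/
theorem IsCyclePattern.exists_touches (hG : G.Connected) (hc : IsCyclePattern G c) {v : V}
    (hv : c v = none) : ∃ l, Touches G c v l := by
  obtain ⟨u, -, hu, -, -⟩ := hc.exists_adj 0
  obtain ⟨a, b, hab, ha, hb⟩ := (hG.preconnected v u).exists_boundary_edge
    (P := (G.monochromatic c).Reachable v) (SimpleGraph.Reachable.refl _) (fun h => by
      have := h.color_eq
      rw [hv, hu] at this
      exact absurd this (by simp))
  have hcb : c b ≠ none := fun h => hb (ha.trans (SimpleGraph.Adj.reachable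
    ⟨hab, ha.color_eq.symm.trans (hv.trans h.symm)⟩))
  obtain ⟨l, hl⟩ := Option.ne_none_iff_exists'.1 hcb
  exact ⟨l, a, b, ha, hl, hab⟩

/-- Some component of the uncolored vertices misses a color class. -/
theorem IsCyclePattern.exists_of_not_touches [Fintype V] (hG : G.Connected)
    (hc : IsCyclePattern G c)
    (hmax : ∀ v u k, c v = none → c u = some k → G.Adj v u → ∃ w, c w = some (k + 2) ∧ G.Adj v w)
    {v₀ : V} (hv₀ : c v₀ = none) {k : Fin 4} (hk : ¬ Touches G c v₀ (k + 1)) :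
    ∃ (d : ℕ) (p : SphericalPlacement V d), IsUniversallyRigid G p ∧ ¬ IsSuperStable G p := by
  classical
  have hopp : ∀ v l, c v = none → Touches G c v l → Touches G c v (l + 2) := by
    rintro v l hv ⟨w, u, hw, hu, hwu⟩
    obtain ⟨x, hx, hwx⟩ := hmax w u l (hw.color_eq.symm.trans hv) hu hwu
    exact ⟨w, x, hw, hx, hwx⟩
  have e1 : k + 1 + 1 = k + 2 := by rw [add_assoc]; rfl
  have e2 : k + 3 + 1 = k := by rw [add_assoc, show (3 + 1 : Fin 4) = 0 from rfl, add_zero]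
  have e3 : k + 3 + 2 = k + 1 := by rw [add_assoc, show (3 + 2 : Fin 4) = 1 from rfl]
  obtain ⟨n0, n1, n3⟩ := (by decide : ∀ k : Fin 4, k ≠ k + 2 ∧ k + 1 ≠ k + 2 ∧ k + 3 ≠ k + 2) k
  -- Class 1 is color k + 2. Class 0 takes the other three colors and the uncolored components
  -- touching k + 1. The components left as `none` touch exactly k and k + 2.
  let τ : V → Option (Fin 2) := fun v =>
    if c v = none ∧ ¬ Touches G c v (k + 1) then none
    else if c v = some (k + 2) then some 1 else some 0
  have τ1 : ∀ v, c v = some (k + 2) → τ v = some 1 := fun v hv => by simp [τ, hv]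
  have τ0 : ∀ v l, c v = some l → l ≠ k + 2 → τ v = some 0 := fun v l hv hl => by
    simp [τ, hv, hl]
  have τn : ∀ v, τ v = none ↔ c v = none ∧ ¬ Touches G c v (k + 1) := fun v => by
    simp only [τ]
    split_ifs with h h' <;> simp [h]
  have τ1' : ∀ v, τ v = some 1 → c v = some (k + 2) := by
    intro v hv
    by_contra h
    by_cases h' : c v = none ∧ ¬ Touches G c v (k + 1)
    · rw [(τn v).2 h'] at hv
      exact absurd hv (by simp)
    · simp [τ, h, h'] at hv
  have hle : G.monochromatic c ≤ G.monochromatic τ := by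
    intro i j hij
    refine ⟨hij.1, ?_⟩
    have hT : Touches G c i (k + 1) ↔ Touches G c j (k + 1) :=
      ⟨Touches.of_reachable hij.symm.reachable, Touches.of_reachable hij.reachable⟩
    simp only [τ, hij.2, hT]
  obtain ⟨a0, a1, ha0, ha1, ha⟩ := hc.exists_adj k
  obtain ⟨b1, b2, hb1, hb2, hb⟩ := hc.exists_adj (k + 1)
  obtain ⟨d3, d0, hd3, hd0, hd⟩ := hc.exists_adj (k + 3)
  rw [e1] at hb2
  rw [e2] at hd0
  have hclass : ∀ i j l, c i = some l → c j = some l → (G.monochromatic τ).Reachable i j :=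
    fun i j l hi hj => (hc.reachable i j (hi.trans hj.symm) (by simp [hi])).mono hle
  have hzero : ∀ i, τ i = some 0 → (G.monochromatic τ).Reachable i a0 := by
    have h1 : ∀ i, c i = some (k + 1) → (G.monochromatic τ).Reachable i a0 := fun i hi =>
      (hclass i a1 _ hi ha1).trans (SimpleGraph.Adj.reachable
        ⟨ha.symm, (τ0 a1 _ ha1 n1).trans (τ0 a0 _ ha0 n0).symm⟩)
    intro i hi
    cases hci : c i with
    | none =>
      have ht : Touches G c i (k + 1) := by
        by_contra ht
        rw [(τn i).2 ⟨hci, ht⟩] at hi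
        exact absurd hi (by simp)
      obtain ⟨w, u, hw, hu, hwu⟩ := ht
      have hwτ := (hw.mono hle).color_eq
      have hwuτ : (G.monochromatic τ).Adj w u :=
        ⟨hwu, hwτ.symm.trans (hi.trans (τ0 u _ hu n1).symm)⟩
      exact (hw.mono hle).trans (hwuτ.reachable.trans (h1 u hu))
    | some l =>
      rcases Fin.eq_add_cases_four k l with rfl | rfl | rfl | rfl
      · exact hclass i a0 _ hci ha0
      · exact h1 i hci
      · rw [τ1 i hci] at hi
        exact absurd hi (by simp)
      · have hdτ : (G.monochromatic τ).Adj d3 d0 :=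
          ⟨hd, (τ0 d3 _ hd3 n3).trans (τ0 d0 _ hd0 n0).symm⟩
        exact (hclass i d3 _ hci hd3).trans (hdτ.reachable.trans (hclass d0 a0 _ hd0 ha0))
  -- Within class 0, color k has no neighbor in the opposite color k + 2, and all other vertices
  -- have no neighbor in `none`.
  refine exists_rigid_not_superStable two_pos τ ?_ ?_ ?_ ?_ ⟨v₀, (τn v₀).2 ⟨hv₀, hk⟩⟩ 0
    {i | c i = some k} (c₁ := some 1) (c₂ := none) (by simp) (by simp) ?_ ?_
  · rw [Fin.forall_fin_two]
    exact ⟨⟨a0, τ0 a0 _ ha0 n0⟩, ⟨b2, τ1 b2 hb2⟩⟩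
  · intro i j hij hi
    obtain ⟨l, hl⟩ := Option.ne_none_iff_exists'.1 hi
    have hl' : τ j = some l := hij ▸ hl
    fin_cases l
    · exact (hzero i hl).trans (hzero j hl').symm
    · exact hclass i j _ (τ1' i hl) (τ1' j hl')
  · intro j l hjl
    have hj : j = 0 := by omega
    have hl : l = 1 := by omega
    subst hj hl
    exact ⟨b1, b2, τ0 b1 _ hb1 n1, τ1 b2 hb2, hb⟩
  · intro v hv
    obtain ⟨hcv, hnt⟩ := (τn v).1 hv
    have hboth : Touches G c v k ∧ Touches G c v (k + 2) := by
      obtain ⟨l, hl⟩ := hc.exists_touches hG hcv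
      rcases Fin.eq_add_cases_four k l with rfl | rfl | rfl | rfl
      · exact ⟨hl, hopp v _ hcv hl⟩
      · exact absurd hl hnt
      · exact ⟨Fin.add_two_add_two_four k ▸ hopp v _ hcv hl, hl⟩
      · exact absurd (e3 ▸ hopp v _ hcv hl) hnt
    rw [Fin.forall_fin_two]
    obtain ⟨⟨w, u, hw, hu, hwu⟩, ⟨w', u', hw', hu', hwu'⟩⟩ := hboth
    exact ⟨⟨w, u, hw.mono hle, τ0 u _ hu n0, hwu⟩, ⟨w', u', hw'.mono hle, τ1 u' hu', hwu'⟩⟩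
  · intro i u _ hi hiu hu
    exact hc.not_adj k i u hi (τ1' u hu) hiu
  · intro i u hi hiZ hiu hu
    obtain ⟨hcu, hnt⟩ := (τn u).1 hu
    cases hci : c i with
    | none =>
      have h : (G.monochromatic c).Adj i u := ⟨hiu, hci.trans hcu.symm⟩
      rw [(hle h).2, hu] at hi
      exact absurd hi (by simp)
    | some l =>
      have ht : Touches G c u l := ⟨u, i, SimpleGraph.Reachable.refl _, hci, hiu.symm⟩
      rcases Fin.eq_add_cases_four k l with rfl | rfl | rfl | rfl
      · exact hiZ hci
      · exact hnt ht
      · rw [τ1 i hci] at hi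
        exact absurd hi (by simp)
      · exact hnt (e3 ▸ hopp u _ hcu ht)

/-- All vertices are colored. -/
theorem IsCyclePattern.exists_of_forall_ne_none [Fintype V] (hc : IsCyclePattern G c)
    (hall : ∀ v, c v ≠ none) :
    ∃ (d : ℕ) (p : SphericalPlacement V d), IsUniversallyRigid G p ∧ ¬ IsSuperStable G p := by
  -- Colors 0 and 1 merge, and color 2 plays the role of `none`. Color 0 misses its opposite 2, and
  -- color 1 misses its opposite 3.
  let g : Option (Fin 4) → Option (Fin 2) := fun t => t.elim none ![some 0, some 0, none, some 1]
  have hτ : ∀ {v l}, c v = some l → (g ∘ c) v = ![some 0, some 0, none, some 1] l :=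
    fun {v l} hv => by simp [g, hv]
  have hle := G.monochromatic_comp_le c g
  obtain ⟨a0, a1, ha0, ha1, ha⟩ := hc.exists_adj 0
  obtain ⟨b1, b2, hb1, hb2, hb⟩ := hc.exists_adj 1
  obtain ⟨d2, d3, hd2, hd3, hd⟩ := hc.exists_adj 2
  obtain ⟨e3, e0, he3, he0, he⟩ := hc.exists_adj 3
  have hclass : ∀ i j l, c i = some l → c j = some l → (G.monochromatic (g ∘ c)).Reachable i j :=
    fun i j l hi hj => (hc.reachable i j (hi.trans hj.symm) (by simp [hi])).mono hle
  have hinv : ∀ v, ((g ∘ c) v = some 0 → c v = some 0 ∨ c v = some 1) ∧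
      ((g ∘ c) v = some 1 → c v = some 3) ∧ ((g ∘ c) v = none → c v = some 2) := by
    intro v
    obtain ⟨l, hl⟩ := Option.ne_none_iff_exists'.1 (hall v)
    rw [hτ hl, hl]
    fin_cases l <;> simp
  have hzero : ∀ i, (g ∘ c) i = some 0 → (G.monochromatic (g ∘ c)).Reachable i a0 := by
    intro i hi
    rcases (hinv i).1 hi with h | h
    · exact hclass i a0 _ h ha0
    · exact (hclass i a1 _ h ha1).trans (SimpleGraph.Adj.reachable
        ⟨ha.symm, (hτ ha1).trans (hτ ha0).symm⟩)
  refine exists_rigid_not_superStable two_pos (g ∘ c) ?_ ?_ ?_ ?_ ⟨b2, hτ hb2⟩ 0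
    {i | c i = some 0} (c₁ := none) (c₂ := some 1) (by simp) (by simp) ?_ ?_
  · rw [Fin.forall_fin_two]
    exact ⟨⟨a0, hτ ha0⟩, ⟨e3, hτ he3⟩⟩
  · intro i j hij hi
    obtain ⟨l, hl⟩ := Option.ne_none_iff_exists'.1 hi
    have hl' : (g ∘ c) j = some l := hij ▸ hl
    fin_cases l
    · exact (hzero i hl).trans (hzero j hl').symm
    · exact hclass i j _ ((hinv i).2.1 hl) ((hinv j).2.1 hl')
  · intro j l hjl
    have hj : j = 0 := by omega
    have hl : l = 1 := by omega
    subst hj hl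
    exact ⟨e0, e3, hτ he0, hτ he3, he.symm⟩
  · intro v hv
    have hv2 := (hinv v).2.2 hv
    rw [Fin.forall_fin_two]
    exact ⟨⟨b2, b1, hclass v b2 _ hv2 hb2, hτ hb1, hb.symm⟩,
      ⟨d2, d3, hclass v d2 _ hv2 hd2, hτ hd3, hd⟩⟩
  · intro i u _ hi hiu hu
    exact hc.not_adj 0 i u hi ((hinv u).2.2 hu) hiu
  · intro i u hi hiZ hiu hu
    exact hc.not_adj 1 i u (((hinv i).1 hi).resolve_left hiZ) ((hinv u).2.1 hu) hiu

/-- Every component of the uncolored vertices is attached to all four classes. -/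
theorem IsCyclePattern.exists_of_touches [Fintype V] (hc : IsCyclePattern G c)
    (ht : ∀ v, c v = none → ∀ k, Touches G c v k) (hne : ∃ v, c v = none) :
    ∃ (d : ℕ) (p : SphericalPlacement V d), IsUniversallyRigid G p ∧ ¬ IsSuperStable G p := by
  -- Merging colors 0 and 1 turns the four-cycle into a triangle, hence d = 3; the uncolored
  -- components touch all three merged classes.
  let g : Option (Fin 4) → Option (Fin 3) :=
    fun t => t.elim none ![some 0, some 0, some 2, some 1]
  have hτ : ∀ {v l}, c v = some l → (g ∘ c) v = ![some 0, some 0, some 2, some 1] l :=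
    fun {v l} hv => by simp [g, hv]
  have hτn : ∀ v, c v = none → (g ∘ c) v = none := fun v hv => by simp [g, hv]
  have hle := G.monochromatic_comp_le c g
  obtain ⟨a0, a1, ha0, ha1, ha⟩ := hc.exists_adj 0
  obtain ⟨b1, b2, hb1, hb2, hb⟩ := hc.exists_adj 1
  obtain ⟨d2, d3, hd2, hd3, hd⟩ := hc.exists_adj 2
  obtain ⟨e3, e0, he3, he0, he⟩ := hc.exists_adj 3
  have hclass : ∀ i j l, c i = some l → c j = some l → (G.monochromatic (g ∘ c)).Reachable i j :=
    fun i j l hi hj => (hc.reachable i j (hi.trans hj.symm) (by simp [hi])).mono hle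
  have hinv : ∀ v, ((g ∘ c) v = some 0 → c v = some 0 ∨ c v = some 1) ∧
      ((g ∘ c) v = some 1 → c v = some 3) ∧ ((g ∘ c) v = some 2 → c v = some 2) ∧
      ((g ∘ c) v = none → c v = none) := by
    intro v
    cases hl : c v with
    | none => rw [hτn v hl]; simp
    | some l => rw [hτ hl]; fin_cases l <;> simp
  have hzero : ∀ i, (g ∘ c) i = some 0 → (G.monochromatic (g ∘ c)).Reachable i a0 := by
    intro i hi
    rcases (hinv i).1 hi with h | h
    · exact hclass i a0 _ h ha0
    · exact (hclass i a1 _ h ha1).trans (SimpleGraph.Adj.reachable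
        ⟨ha.symm, (hτ ha1).trans (hτ ha0).symm⟩)
  refine exists_rigid_not_superStable three_pos (g ∘ c) ?_ ?_ ?_ ?_
    (hne.imp fun v hv => hτn v hv) 0
    {i | c i = some 0} (c₁ := some 2) (c₂ := some 1) (by simp) (by simp) ?_ ?_
  · intro j
    fin_cases j
    exacts [⟨a0, hτ ha0⟩, ⟨e3, hτ he3⟩, ⟨b2, hτ hb2⟩]
  · intro i j hij hi
    obtain ⟨l, hl⟩ := Option.ne_none_iff_exists'.1 hi
    have hl' : (g ∘ c) j = some l := hij ▸ hl
    fin_cases l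
    · exact (hzero i hl).trans (hzero j hl').symm
    · exact hclass i j _ ((hinv i).2.1 hl) ((hinv j).2.1 hl')
    · exact hclass i j _ ((hinv i).2.2.1 hl) ((hinv j).2.2.1 hl')
  · have h01 : ∃ u v, (g ∘ c) u = some 0 ∧ (g ∘ c) v = some 1 ∧ G.Adj u v :=
      ⟨e0, e3, hτ he0, hτ he3, he.symm⟩
    have h02 : ∃ u v, (g ∘ c) u = some 0 ∧ (g ∘ c) v = some 2 ∧ G.Adj u v :=
      ⟨b1, b2, hτ hb1, hτ hb2, hb⟩
    have h12 : ∃ u v, (g ∘ c) u = some 1 ∧ (g ∘ c) v = some 2 ∧ G.Adj u v :=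
      ⟨d3, d2, hτ hd3, hτ hd2, hd.symm⟩
    intro j l hjl
    have h : (j = 0 ∧ l = 1) ∨ (j = 0 ∧ l = 2) ∨ (j = 1 ∧ l = 2) := by omega
    rcases h with ⟨rfl, rfl⟩ | ⟨rfl, rfl⟩ | ⟨rfl, rfl⟩
    exacts [h01, h02, h12]
  · intro v hv j
    have key : ∀ l : Fin 4, ![some 0, some 0, some 2, some 1] l = some j →
        ∃ w u, (G.monochromatic (g ∘ c)).Reachable v w ∧ (g ∘ c) u = some j ∧ G.Adj w u := by
      intro l hl
      obtain ⟨w, u, hw, hu, hwu⟩ := ht v ((hinv v).2.2.2 hv) l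
      exact ⟨w, u, hw.mono hle, (hτ hu).trans hl, hwu⟩
    fin_cases j
    exacts [key 0 rfl, key 3 rfl, key 2 rfl]
  · intro i u _ hi hiu hu
    exact hc.not_adj 0 i u hi ((hinv u).2.2.1 hu) hiu
  · intro i u hi hiZ hiu hu
    exact hc.not_adj 1 i u (((hinv i).1 hi).resolve_left hiZ) ((hinv u).2.1 hu) hiu

theorem exists_rigid_not_superStable_of_hole [Fintype V] (hG : G.Connected) {n : ℕ} (hn : 4 ≤ n)
    (e : SimpleGraph.cycleGraph n ↪g G) :
    ∃ (d : ℕ) (p : SphericalPlacement V d), IsUniversallyRigid G p ∧ ¬ IsSuperStable G p := by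
  obtain ⟨c, hc, hmax⟩ := exists_maximal_isCyclePattern (exists_isCyclePattern_of_hole hn e)
  by_cases hall : ∀ v, c v ≠ none
  · exact hc.exists_of_forall_ne_none hall
  by_cases ht : ∀ v, c v = none → ∀ k, Touches G c v k
  · exact hc.exists_of_touches ht (by simpa using hall)
  push Not at ht
  obtain ⟨v, hv, k, hk⟩ := ht
  -- The missed color is called k + 1 in that lemma, hence the shift.
  refine hc.exists_of_not_touches hG hmax hv (k := k - 1) ?_
  rwa [sub_add_cancel]

end Converse

theorem theorem8p1 {V : Type*} [Fintype V] (G : SimpleGraph V) :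
    (IsChordalGraph G →
      ∀ (d : ℕ) (p : SphericalPlacement V d), IsUniversallyRigid G p → IsSuperStable G p) ∧
    (G.Connected →
      (∀ (d : ℕ) (p : SphericalPlacement V d), IsUniversallyRigid G p → IsSuperStable G p) →
      IsChordalGraph G) := by
  refine ⟨fun hG d p hp => hp.isSuperStable hG, fun hG h n hn => ⟨fun e => ?_⟩⟩
  obtain ⟨d, p, hp, hs⟩ := exists_rigid_not_superStable_of_hole hG hn e
  exact hs (h d p hp)
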